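/- Let $V=(V_1,\dots,V_d)$ be a random vector in $\mathbb R_+^d$ on a probability space, and let $\|\cdot\|$ be a norm on $\mathbb R^d$. Suppose that $V$ is multivariate regularly varying with intensity measure $\mu$: $\mu$ is a nonzero Radon measure on $[0,\infty]^d\setminus\{0\}$ (with the subspace topology of $[0,\infty]^d$) with no mass on the points having an infinite coordinate, and $\mathbb P(V\in t\,\cdot)/\mathbb P(\|V\|>t)$ converges vaguely to $\mu$ as $t\to\infty$. Suppose also that, for some $\alpha>0$ and $K_1,\dots,K_d>0$, $\mathbb P(V_j>t)\sim K_jt^{-\alpha}$ as $t\to\infty$ for every $j$. Let $A_{ij}=W_{ij}\mathbf 1(i\sim j)$ be the weighted adjacency matrix of a random bipartite graph, where $W$ is a random matrix in $\mathbb R_+^{q\times d}$ with $\mathbb E\|W\|_*^{\alpha+\delta}<\infty$ for some norm $\|\cdot\|_*$ on $\mathbb R^{q\times d}$ and some $\delta>0$. Let $A$ be independent of $V$, and put $F=AV$ and $$\tilde\mu(S)=\mathbb E\,\mu\{x\in\mathbb R_+^d\setminus\{0\}:Ax\in S\},\qquad S\subset\mathbb R_+^q\text{ Borel}.$$ Let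 $g,h:\mathbb R_+^q\to\mathbb R_+$ be continuous and $1$-homogeneous ($g(ax)=ag(x)$ and $h(ax)=ah(x)$ for $a>0$), and suppose $\tilde\mu(\{h>1\})>0$. Then $\tilde\mu(\{h>1\})<\infty$, $\mathbb P(h(F)>t)>0$ for all $t\ge0$, and the following hold. (a) For every $u\in(0,\infty)$, $$\lim_{t\to\infty}\mathbb P(g(F)>t\mid h(F)>ut)=u^{\alpha}\,\frac{\tilde\mu(\{x: h(x)>u,\ g(x)>1\})}{\tilde\mu(\{x: h(x)>1\})}.$$ (b) (i) If $g$ is bounded, or if $\{x\ne 0:g(x)\neq0\}$ has compact closure in $[0,\infty]^q\setminus\{0\}$, then, as $t\to\infty$, $$\mathbb E[g(F)\mid h(F)>t]\sim\frac{t}{\tilde\mu(\{h>1\})}\int_{\{h>1\}}g\,d\tilde\mu ,$$ with the convention $0\sim 0$ (a $1$-homogeneous $g$ with either property vanishes identically). (ii) If $\alpha>1$, then, without any further assumption on $g$, $\mathbb E[g(F)]<\infty$, $\int_{\{h>1\}}g\,d\tilde\mu<\infty$ and $$\lim_{t\to\infty}\frac{\mathbb E[g(F)\mid h(F)>t]}{t}=\frac{1}{\tilde\mu(\{h>1\})}\int_{\{h>1\}}g\,d\tilde\mu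 ;$$ in particular the asymptotic equivalence in (i) holds whenever $\int_{\{h>1\}}g\,d\tilde\mu\neq0$. (iii) For every bounded continuous function $f:\mathbb R_+^q\to\mathbb R$, not necessarily homogeneous, $$\lim_{t\to\infty}\mathbb E[f(F/t)\mid h(F)>t]=\frac{1}{\tilde\mu(\{h>1\})}\int_{\{h>1\}}f\,d\tilde\mu .$$ -/

import Mathlib

open MeasureTheory ProbabilityTheory Filter Topology Asymptotics
open scoped NNReal ENNReal Matrix CompactlySupported BoundedContinuousFunction

/-- The product `σ`-algebra on matrices. -/
instance {m n α : Type*} [MeasurableSpace α] : MeasurableSpace (Matrix m n α) :=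
  inferInstanceAs (MeasurableSpace (m → n → α))

/-- The space `[0,∞]^d \ {0}` with its subspace topology (the one point uncompactification of the
compact space `[0,∞]^d`: its relatively compact subsets are those bounded away from `0`). -/
abbrev ExtOrthant (d : ℕ) : Type := {x : Fin d → ℝ≥0∞ // x ≠ 0}

/-- A seminorm `N` on a real vector space is a norm if it vanishes only at `0`. -/
def IsNorm {E : Type*} [AddCommGroup E] [Module ℝ E] (N : Seminorm ℝ E) : Prop :=
  ∀ x, N x = 0 → x = 0

/-- Vague convergence: convergence of the integrals of all continuous functions with compact
support. -/
def VagueTendsto {E ι : Type*} [TopologicalSpace E] [MeasurableSpace E]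
    (ν : ι → Measure E) (l : Filter ι) (μ : Measure E) : Prop :=
  ∀ f : C_c(E, ℝ), Tendsto (fun i => ∫ x, f x ∂(ν i)) l (𝓝 (∫ x, f x ∂μ))

/-- The measure `S ↦ P(X ∈ t S) / P(‖X‖ > t)` on `[0,∞]^d \ {0}`, for a random vector `X` in
`ℝ₊^d` and a norm `N = ‖·‖` on `ℝ^d` (relevant for `t > 0`). -/
noncomputable def scaledLaw {Ω : Type*} [MeasurableSpace Ω] {d : ℕ} (P : Measure Ω)
    (N : Seminorm ℝ (Fin d → ℝ)) (X : Ω → Fin d → ℝ≥0) (t : ℝ≥0) : Measure (ExtOrthant d) :=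
  (P {ω | (t : ℝ) < N (fun j => (X ω j : ℝ))})⁻¹ •
    (P.map (fun ω j => ((X ω j / t : ℝ≥0) : ℝ≥0∞))).comap Subtype.val

/-- `X` is multivariate regularly varying with intensity measure `μ`, with respect to the norm
`N`: `μ` is a nonzero Radon measure on `[0,∞]^d \ {0}` without mass at infinity, and
`P(X ∈ t ·) / P(‖X‖ > t)` converges vaguely to `μ` as `t → ∞`. -/
structure IsRegularlyVarying {Ω : Type*} [MeasurableSpace Ω] {d : ℕ} (P : Measure Ω)
    (N : Seminorm ℝ (Fin d → ℝ)) (X : Ω → Fin d → ℝ≥0) (μ : Measure (ExtOrthant d)) : Prop where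
  radon : IsFiniteMeasureOnCompacts μ
  ne_zero : μ ≠ 0
  infinity_null : μ {x | ∃ j, x.1 j = ∞} = 0
  vague : VagueTendsto (scaledLaw P N X) atTop μ

open Classical in
/-- The weighted adjacency matrix `A i j = W i j * 1(i ∼ j)` of a random bipartite graph with
edges `adj` and weights `W`. -/
noncomputable def weightedAdjacency {Ω : Type*} {q d : ℕ}
    (W : Ω → Matrix (Fin q) (Fin d) ℝ≥0) (adj : Ω → Fin q → Fin d → Prop) (ω : Ω) :
    Matrix (Fin q) (Fin d) ℝ≥0 :=
  Matrix.of fun i j => if adj ω i j then W ω i j else 0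

/-- The measure `E μ ∘ A⁻¹` on `ℝ₊^q`, for a random matrix `A` and a measure `μ` on
`[0,∞]^d \ {0}` without mass at infinity: the image of `P ⊗ μ` under `(ω, x) ↦ A(ω) x`. Its value
on a measurable set `S` is `E[μ {x : A x ∈ S}]`, see `meanImage_apply`. -/
noncomputable def meanImage {Ω : Type*} [MeasurableSpace Ω] {q d : ℕ} (P : Measure Ω)
    (A : Ω → Matrix (Fin q) (Fin d) ℝ≥0) (μ : Measure (ExtOrthant d)) :
    Measure (Fin q → ℝ≥0) :=
  (P.prod μ).map (fun p => A p.1 *ᵥ fun j => (p.2.1 j).toNNReal)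

theorem meanImage_apply {Ω : Type*} [MeasurableSpace Ω] {q d : ℕ} (P : Measure Ω)
    (A : Ω → Matrix (Fin q) (Fin d) ℝ≥0) (hA : Measurable A) (μ : Measure (ExtOrthant d))
    [SFinite μ] (S : Set (Fin q → ℝ≥0)) (hS : MeasurableSet S) :
    meanImage P A μ S =
      ∫⁻ ω, μ {x | (A ω *ᵥ fun j => (x.1 j).toNNReal) ∈ S} ∂P := by
  have hA' : ∀ i j, Measurable fun ω => A ω i j := fun i j =>
    (measurable_pi_apply j).comp ((measurable_pi_apply i).comp hA)
  have hm : Measurable (fun p : Ω × ExtOrthant d => A p.1 *ᵥ fun j => (p.2.1 j).toNNReal) := by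
    refine measurable_pi_lambda _ fun i => ?_
    simp only [Matrix.mulVec, dotProduct]
    refine Finset.measurable_sum _ fun j _ => ?_
    exact ((hA' i j).comp measurable_fst).mul
      (((measurable_pi_apply j).comp (measurable_subtype_coe.comp measurable_snd)).ennreal_toNNReal)
  rw [meanImage, Measure.map_apply hm hS, Measure.prod_apply (hm hS)]
  rfl

/-- Positive homogeneity of degree one of a function on `ℝ₊^q`. -/
def IsOneHomogeneous {q : ℕ} (f : (Fin q → ℝ≥0) → ℝ≥0) : Prop :=
  ∀ (a : ℝ≥0) (x : Fin q → ℝ≥0), 0 < a → f (a • x) = a * f x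

/-- The closure of `{x ∈ ℝ₊^q \ {0} : f x ≠ 0}` in `[0,∞]^q \ {0}` is compact. -/
def HasCompactSupportInExtOrthant {q : ℕ} (f : (Fin q → ℝ≥0) → ℝ≥0) : Prop :=
  IsCompact (closure {y : ExtOrthant q | ∃ x : Fin q → ℝ≥0, f x ≠ 0 ∧ ∀ i, y.1 i = (x i : ℝ≥0∞)})

/-! ### Approximation of limits and piecewise linear cut-offs -/

section Auxiliary

/-! Everything is reduced to one statement, `TailLimit`: `t ^ α * E φ(F / t)` converges to `c * ∫ φ
dμt` for bounded continuous `φ` vanishing near `0`, together with power bounds on the tails of `F`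
and of the limit. The constant `c` disappears in every conditional quantity, since these are ratios.

For `V`, some coordinate is charged by `μ` away from `0`. Comparing its Pareto tail with the vague
limit gives `P(‖V‖ > t) ~ const * t ^ (-α)`, so the norm can be forgotten. Passing from `[0,∞]^d \
{0}` to `ℝ₊^d` costs only a tail term, because `μ` has no mass at infinity. For `F = A V` one
conditions on `A` (Breiman): with `A` fixed, `x ↦ φ (A x)` is again a test function, and the
rescaled expectation is dominated by a constant times the `α`-th power of the sum of the entries of
`A`, which the moment assumption makes integrable (`TailLimit.mulVec`).

The limit is homogeneous of order `-α`. Therefore level sets `{k > 1}` of continuous one-homogeneous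
`k` may be used in place of continuous test functions: a smoothing of the indicator and a slight
dilation of it have nearly equal integrals (`TailLimit.tendsto_setIntegral`). This yields (b)(iii);
applied to `k = min (h / u) g` it yields (a). For (b)(ii), `g` is truncated: when `α > 1`, the part
of `g (F) / t` above level `b` contributes `O(b ^ (1 - α))` uniformly in `t`. In (b)(i), homogeneity
forces `g = 0`. -/

theorem tendsto_of_approx {ι : Type*} {l : Filter ι} {F : ι → ℝ} {G E : ℕ → ι → ℝ} {L e : ℕ → ℝ}
    {a : ℝ} (hG : ∀ n, Tendsto (G n) l (𝓝 (L n))) (hL : Tendsto L atTop (𝓝 a))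
    (hE : ∀ n, Tendsto (E n) l (𝓝 (e n))) (he : Tendsto e atTop (𝓝 0))
    (hb : ∀ n, ∀ᶠ i in l, |F i - G n i| ≤ E n i) : Tendsto F l (𝓝 a) := by
  rw [Metric.tendsto_nhds]
  intro r hr
  -- Four errors of size `r / 4`: `G n` to `L n`, `L n` to `a`, `E n` to `e n`, and `e n` to `0`.
  obtain ⟨n, hn1, hn2⟩ := ((Metric.tendsto_nhds.1 hL (r / 4) (by positivity)).and
    (Metric.tendsto_nhds.1 he (r / 4) (by positivity))).exists
  filter_upwards [hb n, Metric.tendsto_nhds.1 (hG n) (r / 4) (by positivity),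
    Metric.tendsto_nhds.1 (hE n) (r / 4) (by positivity)] with i h1 h2 h3
  rw [Real.dist_eq, abs_lt] at *
  rw [abs_le] at h1
  constructor <;> linarith

/-- The continuous function on `[0,∞]` that is `0` up to `1`, `1` from `2` on, and linear in
between. -/
noncomputable def ramp (y : ℝ≥0∞) : ℝ := (min (y - 1) 1).toReal

theorem continuous_ramp : Continuous ramp := by
  have h : Continuous fun y : ℝ≥0∞ => min (y - 1) 1 :=
    (ENNReal.continuous_sub_right 1).min continuous_const
  refine continuous_iff_continuousAt.2 fun y => ?_
  exact (ENNReal.tendsto_toReal (ne_top_of_le_ne_top ENNReal.one_ne_top (min_le_right _ _))).comp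
    h.continuousAt

theorem ramp_nonneg (y : ℝ≥0∞) : 0 ≤ ramp y := ENNReal.toReal_nonneg

theorem ramp_le_one (y : ℝ≥0∞) : ramp y ≤ 1 :=
  ENNReal.toReal_le_of_le_ofReal zero_le_one (by simp)

theorem ramp_eq_zero {y : ℝ≥0∞} (hy : y ≤ 1) : ramp y = 0 := by
  simp [ramp, tsub_eq_zero_of_le hy]

theorem ramp_eq_one {y : ℝ≥0∞} (hy : 2 ≤ y) : ramp y = 1 := by
  have : 1 ≤ y - 1 := by
    refine ENNReal.le_sub_of_add_le_left ENNReal.one_ne_top ?_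
    rwa [one_add_one_eq_two]
  simp [ramp, this]

theorem ramp_pos {y : ℝ≥0∞} (hy : 1 < y) : 0 < ramp y := by
  refine ENNReal.toReal_pos ?_ (ne_top_of_le_ne_top ENNReal.one_ne_top (min_le_right _ _))
  simp [tsub_eq_zero_iff_le, hy]

theorem ramp_coe (y : ℝ≥0) : ramp y = max 0 (min ((y : ℝ) - 1) 1) := by
  rcases le_total y 1 with h | h
  · rw [ramp_eq_zero (by exact_mod_cast h)]
    have : (y : ℝ) ≤ 1 := h
    rw [max_eq_left (min_le_of_left_le (by linarith))]
  · have h' : (1 : ℝ) ≤ y := h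
    rw [max_eq_right (le_min (by linarith) zero_le_one), ramp, ← ENNReal.coe_one,
      ← ENNReal.coe_sub, ← ENNReal.coe_min, ENNReal.coe_toReal, NNReal.coe_min, NNReal.coe_sub h]
    rfl

/-- `0 ≤ f` integrable and `1 ≤ f` on `B` bound the measure of `B`. -/
theorem measure_le_ofReal_integral {X : Type*} [MeasurableSpace X] {μ : Measure X} {f : X → ℝ}
    (hf : Integrable f μ) (h0 : ∀ x, 0 ≤ f x) {B : Set X} (hB : ∀ x ∈ B, 1 ≤ f x) :
    μ B ≤ ENNReal.ofReal (∫ x, f x ∂μ) := by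
  rw [ofReal_integral_eq_lintegral_ofReal hf (ae_of_all _ h0)]
  calc μ B ≤ μ {x | 1 ≤ ENNReal.ofReal (f x)} := measure_mono fun x hx => by
        simpa using hB x hx
    _ ≤ _ := by
        have := mul_meas_ge_le_lintegral₀ (hf.1.aemeasurable.ennreal_ofReal) 1
        simpa using this

theorem integral_le_measureReal {X : Type*} [MeasurableSpace X] {μ : Measure X} {f : X → ℝ}
    [IsFiniteMeasure μ] {B : Set X} (hm : MeasurableSet B) (h0 : ∀ x, 0 ≤ f x) {b : ℝ}
    (hB : ∀ x ∈ B, f x ≤ b) (hB' : ∀ x ∉ B, f x = 0) :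
    ∫ x, f x ∂μ ≤ b * μ.real B := by
  have : ∫ x, B.indicator (fun _ => b) x ∂μ = b * μ.real B := by
    rw [integral_indicator hm]; simp [mul_comm]
  rw [← this]
  refine integral_mono_of_nonneg (ae_of_all _ h0)
    ((integrable_const b).indicator hm) (ae_of_all _ fun x => ?_)
  by_cases hx : x ∈ B
  · simpa [hx] using hB x hx
  · simp [hx, hB' x hx]

end Auxiliary

/-! ### Test functions on the punctured extended orthant -/

section ExtOrthant

variable {d : ℕ}

instance : LocallyCompactSpace (ExtOrthant d) :=
  (isOpen_ne : IsOpen {x : Fin d → ℝ≥0∞ | x ≠ 0}).locallyCompactSpace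

instance : SecondCountableTopology (ExtOrthant d) :=
  TopologicalSpace.Subtype.secondCountableTopology _

/-- Seen in the compact space `[0,∞]^d` the set is closed, and `ε > 0` keeps it off the removed
point. Hence vanishing near `0` is enough for compact support. -/
theorem ExtOrthant.isCompact_le_sum {ε : ℝ≥0∞} (hε : 0 < ε) :
    IsCompact {x : ExtOrthant d | ε ≤ ∑ j, x.1 j} := by
  rw [Subtype.isCompact_iff]
  have : Subtype.val '' {x : ExtOrthant d | ε ≤ ∑ j, x.1 j} =
      {x : Fin d → ℝ≥0∞ | ε ≤ ∑ j, x j} := by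
    ext x
    simp only [Set.mem_image, Set.mem_ofPred_eq, Subtype.exists, exists_and_right, exists_eq_right]
    constructor
    · rintro ⟨_, h⟩; exact h
    · intro h
      refine ⟨?_, h⟩
      rintro rfl
      simp [hε.ne'] at h
  rw [this]
  exact (isClosed_le continuous_const (by fun_prop)).isCompact

/-- The restriction to `[0,∞]^d \ {0}` of a continuous function vanishing near `0`. -/
noncomputable def ExtOrthant.testFunction (Ψ : (Fin d → ℝ≥0∞) → ℝ) (hΨ : Continuous Ψ) {ε : ℝ≥0∞}
    (hε : 0 < ε) (h0 : ∀ x, ∑ j, x j ≤ ε → Ψ x = 0) : C_c(ExtOrthant d, ℝ) where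
  toFun x := Ψ x.1
  continuous_toFun := hΨ.comp continuous_subtype_val
  hasCompactSupport' := HasCompactSupport.intro (ExtOrthant.isCompact_le_sum hε)
    fun x hx => h0 _ (by simpa using (not_le.1 hx).le)

/-- Because `Ψ 0 = 0`, the part of the law of `V` sitting at the removed origin contributes nothing,
and the integral can be taken over the whole cube. -/
theorem integral_scaledLaw {Ω : Type*} [MeasurableSpace Ω] {P : Measure Ω}
    {N : Seminorm ℝ (Fin d → ℝ)} {V : Ω → Fin d → ℝ≥0} (hV : Measurable V)
    {Ψ : (Fin d → ℝ≥0∞) → ℝ} (hΨ : Continuous Ψ) (h0 : Ψ 0 = 0) (t : ℝ≥0) :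
    ∫ x, Ψ x.1 ∂(scaledLaw P N V t) =
      (P.real {ω | (t : ℝ) < N (fun j => (V ω j : ℝ))})⁻¹ *
        ∫ ω, Ψ (fun j => (((t⁻¹ • V ω) j : ℝ≥0) : ℝ≥0∞)) ∂P := by
  have hs : MeasurableSet {x : Fin d → ℝ≥0∞ | x ≠ 0} := isOpen_ne.measurableSet
  have hm : Measurable fun ω j => ((V ω j / t : ℝ≥0) : ℝ≥0∞) := by fun_prop
  rw [scaledLaw, integral_smul_measure, ENNReal.toReal_inv, smul_eq_mul]
  congr 1
  refine (integral_subtype_comap hs Ψ).trans ?_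
  rw [setIntegral_eq_integral_of_forall_compl_eq_zero (fun x hx => ?_),
    integral_map hm.aemeasurable hΨ.aestronglyMeasurable]
  · simp only [Pi.smul_apply, smul_eq_mul, div_eq_inv_mul]
  · simp only [Set.mem_ofPred_eq, ne_eq, not_not] at hx
    rw [hx, h0]

variable {Ω : Type*} [MeasurableSpace Ω] {P : Measure Ω}
    {N : Seminorm ℝ (Fin d → ℝ)} {V : Ω → Fin d → ℝ≥0} {μ : Measure (ExtOrthant d)}

theorem IsRegularlyVarying.tendsto_integral (hRV : IsRegularlyVarying P N V μ) (hV : Measurable V)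
    {Ψ : (Fin d → ℝ≥0∞) → ℝ} (hΨ : Continuous Ψ) {ε : ℝ≥0∞}
    (hε : 0 < ε) (h0 : ∀ x, ∑ j, x j ≤ ε → Ψ x = 0) :
    Tendsto (fun t : ℝ≥0 => (P.real {ω | (t : ℝ) < N (fun j => (V ω j : ℝ))})⁻¹ *
        ∫ ω, Ψ (fun j => (((t⁻¹ • V ω) j : ℝ≥0) : ℝ≥0∞)) ∂P) atTop (𝓝 (∫ x, Ψ x.1 ∂μ)) := by
  have := hRV.vague (ExtOrthant.testFunction Ψ hΨ hε h0)
  refine this.congr fun t => ?_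
  exact integral_scaledLaw hV hΨ (h0 0 (by simp)) t

theorem IsRegularlyVarying.integrable (hRV : IsRegularlyVarying P N V μ)
    {Ψ : (Fin d → ℝ≥0∞) → ℝ} (hΨ : Continuous Ψ) {ε : ℝ≥0∞}
    (hε : 0 < ε) (h0 : ∀ x, ∑ j, x j ≤ ε → Ψ x = 0) : Integrable (fun x => Ψ x.1) μ :=
  have := hRV.radon
  (ExtOrthant.testFunction Ψ hΨ hε h0).continuous.integrable_of_hasCompactSupport
    (ExtOrthant.testFunction Ψ hΨ hε h0).hasCompactSupport

theorem ramp_coord_eq_zero {a : ℝ≥0} (j : Fin d) (x : Fin d → ℝ≥0∞)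
    (hx : ∑ i, x i ≤ a) : ramp ((a : ℝ≥0∞)⁻¹ * x j) = 0 := by
  refine ramp_eq_zero ?_
  have : x j ≤ a := (Finset.single_le_sum (f := x) (fun _ _ => zero_le) (Finset.mem_univ j)).trans hx
  calc (a : ℝ≥0∞)⁻¹ * x j ≤ (a : ℝ≥0∞)⁻¹ * a := by gcongr
    _ ≤ 1 := ENNReal.inv_mul_le_one _

theorem continuous_ramp_coord {a : ℝ≥0} (ha : 0 < a) (j : Fin d) :
    Continuous fun x : Fin d → ℝ≥0∞ => ramp ((a : ℝ≥0∞)⁻¹ * x j) :=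
  continuous_ramp.comp ((ENNReal.continuous_const_mul (by simp [ha.ne'])).comp
    (continuous_apply j))

/-- Some coordinate carries mass away from `0`. -/
theorem IsRegularlyVarying.exists_pos (hRV : IsRegularlyVarying P N V μ) :
    ∃ (j : Fin d) (a : ℝ≥0), 0 < a ∧ 0 < ∫ x, ramp ((a : ℝ≥0∞)⁻¹ * x.1 j) ∂μ := by
  by_contra! H
  apply hRV.ne_zero
  -- A nonnegative function without integral vanishes almost everywhere, and `ramp` is positive past
  -- `1`. The null sets obtained this way cover the punctured space.
  have key : ∀ (j : Fin d) (n : ℕ), μ {x | 1 < ((((n : ℝ≥0) + 1)⁻¹ : ℝ≥0) : ℝ≥0∞)⁻¹ * x.1 j} = 0 := by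
    intro j n
    have ha : 0 < ((n : ℝ≥0) + 1)⁻¹ := by positivity
    have h1 := H j _ ha
    have hi := hRV.integrable (continuous_ramp_coord ha j) (ε := (((n : ℝ≥0) + 1)⁻¹ : ℝ≥0))
      (by exact_mod_cast ha) (ramp_coord_eq_zero j)
    have h2 := (integral_eq_zero_iff_of_nonneg (fun _ => ramp_nonneg _) hi).1
      (le_antisymm h1 (integral_nonneg fun _ => ramp_nonneg _))
    refine measure_mono_null (fun x hx => ?_) (ae_iff.1 h2)
    simpa using (ramp_pos hx).ne'
  rw [← Measure.measure_univ_eq_zero]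
  refine measure_mono_null (t := ⋃ (j : Fin d) (n : ℕ),
    {x | 1 < ((((n : ℝ≥0) + 1)⁻¹ : ℝ≥0) : ℝ≥0∞)⁻¹ * x.1 j}) (fun x _ => ?_)
    (measure_iUnion_null fun j => measure_iUnion_null fun n => key j n)
  obtain ⟨j, hj⟩ : ∃ j, x.1 j ≠ 0 := Function.ne_iff.1 x.2
  obtain ⟨n, hn⟩ := ENNReal.exists_inv_nat_lt hj
  simp only [Set.mem_iUnion, Set.mem_ofPred_eq]
  refine ⟨j, n, ?_⟩
  rw [ENNReal.coe_inv (by positivity), inv_inv, mul_comm,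
    ← ENNReal.div_lt_iff (by simp) (by simp), one_div]
  refine lt_of_le_of_lt ?_ hn
  simp

end ExtOrthant

/-- The law of `X` has a tail limit `ν` at rate `t ^ α`: there are power bounds on the tails of `X`
and of `ν`, and `t ^ α P(X / t ∈ ·)` converges to `ν` on bounded continuous functions vanishing
near `0`. -/
structure TailLimit {Ω : Type*} [MeasurableSpace Ω] {n : ℕ} (P : Measure Ω) (X : Ω → Fin n → ℝ≥0)
    (α : ℝ) (ν : Measure (Fin n → ℝ≥0)) : Prop where
  tail : ∃ C : ℝ, 0 ≤ C ∧ ∀ s : ℝ≥0, 0 < s → P.real {ω | s < ∑ j, X ω j} ≤ C * (s : ℝ) ^ (-α)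
  limit_tail : ∃ C : ℝ, 0 ≤ C ∧ ∀ s : ℝ≥0, 0 < s →
    ν {x | s < ∑ j, x j} ≤ ENNReal.ofReal (C * (s : ℝ) ^ (-α))
  tendsto : ∀ (φ : (Fin n → ℝ≥0) →ᵇ ℝ) (ε : ℝ≥0), 0 < ε → (∀ x, ∑ j, x j ≤ ε → φ x = 0) →
    Tendsto (fun t : ℝ≥0 => (t : ℝ) ^ α * ∫ ω, φ (t⁻¹ • X ω) ∂P) atTop (𝓝 (∫ x, φ x ∂ν))

/-! ### One-dimensional Pareto tails -/

section Pareto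

variable {Ω : Type*} [MeasurableSpace Ω] {P : Measure Ω} {Y : Ω → ℝ≥0} {α K : ℝ}

theorem tendsto_rpow_mul_tail (hK : 0 < K)
    (hY : (fun t : ℝ≥0 => P.real {ω | t < Y ω}) ~[atTop] (fun t : ℝ≥0 => K * (t : ℝ) ^ (-α))) :
    Tendsto (fun t : ℝ≥0 => (t : ℝ) ^ α * P.real {ω | t < Y ω}) atTop (𝓝 K) := by
  have hne : ∀ᶠ t : ℝ≥0 in atTop, K * (t : ℝ) ^ (-α) ≠ 0 := by
    filter_upwards [eventually_gt_atTop 0] with t ht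
    have : (0 : ℝ) < t := ht
    positivity
  have := ((isEquivalent_iff_tendsto_one hne).1 hY).const_mul K
  rw [mul_one] at this
  refine this.congr' ?_
  filter_upwards [eventually_gt_atTop 0] with t ht
  have h0 : (0 : ℝ) < t := ht
  have h1 : (0 : ℝ) < (t : ℝ) ^ α := by positivity
  simp only [Pi.div_apply]
  rw [Real.rpow_neg h0.le]
  field_simp

/-- Past some `t₀` the limit `K` gives the constant `K + 1`; below `t₀` the trivial bound `1` on a
probability suffices. Validity for every `s > 0` matters later, when the threshold is divided by the
size of a random matrix. -/
theorem exists_tail_bound [IsProbabilityMeasure P] (hα : 0 < α) (hK : 0 < K)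
    (hY : (fun t : ℝ≥0 => P.real {ω | t < Y ω}) ~[atTop] (fun t : ℝ≥0 => K * (t : ℝ) ^ (-α))) :
    ∃ C : ℝ, 0 ≤ C ∧ ∀ s : ℝ≥0, 0 < s → P.real {ω | s < Y ω} ≤ C * (s : ℝ) ^ (-α) := by
  obtain ⟨t₀, ht₀⟩ := eventually_atTop.1
    ((tendsto_rpow_mul_tail hK hY).eventually (eventually_le_nhds (show K < K + 1 by linarith)))
  refine ⟨max (K + 1) ((t₀ : ℝ) ^ α), by positivity, fun s hs => ?_⟩
  have h0 : (0 : ℝ) < s := hs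
  have h1 : (0 : ℝ) < (s : ℝ) ^ α := by positivity
  rw [Real.rpow_neg h0.le, ← div_eq_mul_inv, le_div_iff₀ h1, mul_comm]
  rcases le_total t₀ s with h | h
  · exact (ht₀ s h).trans (le_max_left _ _)
  · refine le_trans ?_ (le_max_right _ _)
    calc (s : ℝ) ^ α * P.real {ω | s < Y ω} ≤ (s : ℝ) ^ α * 1 := by gcongr; exact measureReal_le_one
      _ ≤ (t₀ : ℝ) ^ α := by
        rw [mul_one]; exact Real.rpow_le_rpow h0.le (by exact_mod_cast h) hα.le

theorem tendsto_rpow_mul_tail_const_mul (hK : 0 < K)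
    (hY : (fun t : ℝ≥0 => P.real {ω | t < Y ω}) ~[atTop] (fun t : ℝ≥0 => K * (t : ℝ) ^ (-α)))
    {b : ℝ≥0} (hb : 0 < b) :
    Tendsto (fun t : ℝ≥0 => (t : ℝ) ^ α * P.real {ω | b * t < Y ω}) atTop
      (𝓝 ((b : ℝ) ^ (-α) * K)) := by
  have h := ((tendsto_rpow_mul_tail hK hY).comp
    (tendsto_id.const_mul_atTop hb)).const_mul ((b : ℝ) ^ (-α))
  refine h.congr fun t => ?_
  have hb' : (0 : ℝ) < b := hb
  simp only [Function.comp, id, NNReal.coe_mul]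
  rw [Real.mul_rpow hb'.le t.coe_nonneg, Real.rpow_neg hb'.le]
  have : (0 : ℝ) < (b : ℝ) ^ α := by positivity
  field_simp

/-- This turns the level sets in the layer cake formula for `ramp` into tail events. -/
theorem lt_ramp_iff {a t : ℝ≥0} (ha : 0 < a) (ht : 0 < t) (y : ℝ≥0) {s : ℝ≥0} (hs : s < 1) :
    (s : ℝ) < ramp ((a : ℝ≥0∞)⁻¹ * (t⁻¹ * y : ℝ≥0)) ↔ a * (1 + s) * t < y := by
  have h1 : (s : ℝ) < 1 := hs
  have ha' : (0 : ℝ) < a := ha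
  have ht' : (0 : ℝ) < t := ht
  rw [← ENNReal.coe_inv ha.ne', ← ENNReal.coe_mul, ramp_coe, lt_max_iff, lt_min_iff,
    ← NNReal.coe_lt_coe]
  push_cast
  have e : (a : ℝ)⁻¹ * ((t : ℝ)⁻¹ * y) = y / (a * t) := by field_simp
  rw [e]
  constructor
  · rintro (h | h)
    · exact absurd h (not_lt.2 s.2)
    · have := h.1
      have : (1 + (s : ℝ)) < y / (a * t) := by linarith
      rw [lt_div_iff₀ (by positivity)] at this
      linarith
  · intro h
    refine Or.inr ⟨?_, h1⟩
    rw [lt_sub_iff_add_lt, lt_div_iff₀ (by positivity)]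
    linarith

/-- By the layer cake formula the expectation is an integral over levels `s ∈ (0, 1)` of the tails
of `Y` at `a (1 + s) t`. Rescaled, these converge pointwise and are dominated by the tail bound at
`a t`. -/
theorem exists_tendsto_ramp [IsProbabilityMeasure P] (hα : 0 < α) (hK : 0 < K) (hYm : Measurable Y)
    (hY : (fun t : ℝ≥0 => P.real {ω | t < Y ω}) ~[atTop] (fun t : ℝ≥0 => K * (t : ℝ) ^ (-α)))
    {a : ℝ≥0} (ha : 0 < a) :
    ∃ L : ℝ, 0 < L ∧ Tendsto (fun t : ℝ≥0 => (t : ℝ) ^ α *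
      ∫ ω, ramp ((a : ℝ≥0∞)⁻¹ * (t⁻¹ * Y ω : ℝ≥0)) ∂P) atTop (𝓝 L) := by
  obtain ⟨C, hC0, hC⟩ := exists_tail_bound hα hK hY
  have hm : ∀ t : ℝ≥0, Measurable fun ω => ramp ((a : ℝ≥0∞)⁻¹ * (t⁻¹ * Y ω : ℝ≥0)) := fun t =>
    continuous_ramp.measurable.comp (by fun_prop)
  have hint : ∀ t : ℝ≥0, Integrable (fun ω => ramp ((a : ℝ≥0∞)⁻¹ * (t⁻¹ * Y ω : ℝ≥0))) P :=
    fun t => Integrable.of_bound (hm t).aestronglyMeasurable 1 (ae_of_all _ fun ω => by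
      rw [Real.norm_of_nonneg (ramp_nonneg _)]; exact ramp_le_one _)
  have ha' : (0 : ℝ) < a := ha
  have hlim : Tendsto (fun t : ℝ≥0 => (t : ℝ) ^ α *
      ∫ ω, ramp ((a : ℝ≥0∞)⁻¹ * (t⁻¹ * Y ω : ℝ≥0)) ∂P) atTop
      (𝓝 (∫ s in Set.Ioi (0 : ℝ), (Set.Ioo (0 : ℝ) 1).indicator
        (fun s => (a * (1 + s)) ^ (-α) * K) s)) := by
    have e : ∀ t : ℝ≥0, (t : ℝ) ^ α * ∫ ω, ramp ((a : ℝ≥0∞)⁻¹ * (t⁻¹ * Y ω : ℝ≥0)) ∂P =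
        ∫ s in Set.Ioi (0 : ℝ), (t : ℝ) ^ α *
          P.real {ω | s < ramp ((a : ℝ≥0∞)⁻¹ * (t⁻¹ * Y ω : ℝ≥0))} := fun t => by
      rw [(hint t).integral_eq_integral_meas_lt (ae_of_all _ fun _ => ramp_nonneg _),
        integral_const_mul]
    simp_rw [e]
    refine tendsto_integral_filter_of_dominated_convergence
      ((Set.Ioo (0 : ℝ) 1).indicator (fun s => (a : ℝ) ^ (-α) * C)) ?_ ?_ ?_ ?_
    · refine Eventually.of_forall fun t => Measurable.aestronglyMeasurable ?_
      refine Measurable.const_mul (Antitone.measurable fun s s' h => ?_) _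
      exact measureReal_mono fun ω hω => lt_of_le_of_lt h hω
    · filter_upwards [eventually_gt_atTop 0] with t ht
      have ht' : (0 : ℝ) < t := ht
      refine (ae_restrict_mem measurableSet_Ioi).mono fun s hs => ?_
      rw [Real.norm_of_nonneg (by positivity)]
      by_cases h1 : s < 1
      · rw [Set.indicator_of_mem (show s ∈ Set.Ioo (0 : ℝ) 1 from ⟨hs, h1⟩)]
        lift s to ℝ≥0 using (le_of_lt hs)
        simp_rw [lt_ramp_iff ha ht _ (show s < 1 from h1)]
        calc (t : ℝ) ^ α * P.real {ω | a * (1 + s) * t < Y ω}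
            ≤ (t : ℝ) ^ α * P.real {ω | a * t < Y ω} := by
              have hle : a ≤ a * (1 + s) := le_mul_of_one_le_right zero_le le_self_add
              refine mul_le_mul_of_nonneg_left (measureReal_mono fun ω hω => ?_) (by positivity)
              exact lt_of_le_of_lt (mul_le_mul_of_nonneg_right hle zero_le) hω
          _ ≤ (t : ℝ) ^ α * (C * ((a * t : ℝ≥0) : ℝ) ^ (-α)) := by
              gcongr; exact hC _ (by positivity)
          _ = (a : ℝ) ^ (-α) * C := by
              have : (0 : ℝ) < (t : ℝ) ^ α := by positivity
              rw [NNReal.coe_mul, Real.mul_rpow ha'.le ht'.le, Real.rpow_neg ht'.le]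
              field_simp
      · rw [Set.indicator_of_notMem (fun h => h1 h.2)]
        have : {ω | s < ramp ((a : ℝ≥0∞)⁻¹ * (t⁻¹ * Y ω : ℝ≥0))} = ∅ := by
          ext ω
          simpa using (ramp_le_one _).trans (not_lt.1 h1)
        rw [this]; simp
    · refine Integrable.integrableOn ?_
      rw [integrable_indicator_iff measurableSet_Ioo]
      exact integrableOn_const (by simp)
    · refine (ae_restrict_mem measurableSet_Ioi).mono fun s hs => ?_
      by_cases h1 : s < 1
      · rw [Set.indicator_of_mem (show s ∈ Set.Ioo (0 : ℝ) 1 from ⟨hs, h1⟩)]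
        lift s to ℝ≥0 using (le_of_lt hs)
        have := tendsto_rpow_mul_tail_const_mul hK hY (show 0 < a * (1 + s) by positivity)
        push_cast at this
        refine this.congr' ?_
        filter_upwards [eventually_gt_atTop 0] with t ht
        simp_rw [lt_ramp_iff ha ht _ (show s < 1 from h1)]
      · rw [Set.indicator_of_notMem (fun h => h1 h.2)]
        have : ∀ t : ℝ≥0, {ω | s < ramp ((a : ℝ≥0∞)⁻¹ * (t⁻¹ * Y ω : ℝ≥0))} = ∅ := fun t => by
          ext ω
          simpa using (ramp_le_one _).trans (not_lt.1 h1)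
        simp_rw [this]; simp
  refine ⟨_, ?_, hlim⟩
  -- The limit is positive because `ramp` equals `1` from `2` on, so the expectation dominates the
  -- tail of `Y` at `2 a t`.
  refine lt_of_lt_of_le ?_ (le_of_tendsto_of_tendsto (tendsto_rpow_mul_tail_const_mul hK hY
    (show 0 < 2 * a by positivity)) hlim ?_)
  · positivity
  filter_upwards [eventually_gt_atTop 0] with t ht
  gcongr
  have hms : MeasurableSet {ω | 2 * a * t < Y ω} := measurableSet_lt measurable_const hYm
  rw [← integral_indicator_one hms]
  refine integral_mono ((integrable_const 1).indicator hms) (hint t) fun ω => ?_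
  by_cases hω : 2 * a * t < Y ω
  · rw [Set.indicator_of_mem (by exact hω)]
    refine (ramp_eq_one ?_).ge
    rw [← ENNReal.coe_inv ha.ne', ← ENNReal.coe_mul]
    have : 2 ≤ a⁻¹ * (t⁻¹ * Y ω) := by
      rw [← mul_assoc, ← mul_inv, ← div_eq_inv_mul, le_div_iff₀ (by positivity), ← mul_assoc]
      exact hω.le
    exact_mod_cast this
  · rw [Set.indicator_of_notMem (by exact hω)]
    exact ramp_nonneg _

end Pareto

/-! ### From vague convergence to a tail limit for `V` -/

section RegularVariation

variable {d : ℕ} {Ω : Type*} [MeasurableSpace Ω] {P : Measure Ω} [IsProbabilityMeasure P]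
  {N : Seminorm ℝ (Fin d → ℝ)} {V : Ω → Fin d → ℝ≥0} {μ : Measure (ExtOrthant d)}
  {α : ℝ} {K : Fin d → ℝ}

/-- The normalization `P(‖V‖ > t)` may be replaced by a multiple of `t ^ (-α)`. -/
theorem IsRegularlyVarying.exists_tendsto_rpow_mul (hRV : IsRegularlyVarying P N V μ)
    (hV : Measurable V) (hα : 0 < α) (hK : ∀ j, 0 < K j)
    (hPareto : ∀ j, (fun t : ℝ≥0 => P.real {ω | t < V ω j}) ~[atTop]
      (fun t : ℝ≥0 => K j * (t : ℝ) ^ (-α))) :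
    ∃ c : ℝ, 0 < c ∧ ∀ (Ψ : (Fin d → ℝ≥0∞) → ℝ) (ε : ℝ≥0∞), Continuous Ψ → 0 < ε →
      (∀ x, ∑ j, x j ≤ ε → Ψ x = 0) →
      Tendsto (fun t : ℝ≥0 => (t : ℝ) ^ α *
        ∫ ω, Ψ (fun j => (((t⁻¹ • V ω) j : ℝ≥0) : ℝ≥0∞)) ∂P) atTop (𝓝 (c * ∫ x, Ψ x.1 ∂μ)) := by
  obtain ⟨j, a, ha, hI⟩ := hRV.exists_pos
  obtain ⟨L, hL, hLlim⟩ := exists_tendsto_ramp hα (hK j) ((measurable_pi_apply j).comp hV)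
    (hPareto j) ha
  have hI' := hRV.tendsto_integral hV (continuous_ramp_coord ha j) (ε := a)
    (by exact_mod_cast ha) (ramp_coord_eq_zero j)
  -- A vanishing denominator would have inverse `0` and make the normalized integral `0`, against
  -- its nonzero limit.
  have hρ : ∀ᶠ t : ℝ≥0 in atTop, P.real {ω | (t : ℝ) < N (fun j => (V ω j : ℝ))} ≠ 0 := by
    filter_upwards [hI'.eventually_ne hI.ne'] with t ht h
    rw [h, inv_zero, zero_mul] at ht
    exact ht rfl
  -- The same `ramp` expectation has a limit under both normalizations; in the quotient it cancels
  -- and leaves the tail of the norm.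
  have hc : Tendsto (fun t : ℝ≥0 => (t : ℝ) ^ α *
      P.real {ω | (t : ℝ) < N (fun j => (V ω j : ℝ))}) atTop
      (𝓝 (L / ∫ x, ramp ((a : ℝ≥0∞)⁻¹ * x.1 j) ∂μ)) := by
    refine (hLlim.div hI' hI.ne').congr' ?_
    filter_upwards [hρ, hI'.eventually_ne hI.ne'] with t h1 h2
    simp only [Pi.smul_apply, smul_eq_mul, Function.comp_apply, Pi.div_apply] at h2 ⊢
    have h3 := right_ne_zero_of_mul h2
    rw [mul_div_mul_comm, div_inv_eq_mul, div_self h3, mul_one]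
  refine ⟨_, div_pos hL hI, fun Ψ ε hΨ hε h0 => ?_⟩
  refine (hc.mul (hRV.tendsto_integral hV hΨ hε h0)).congr' ?_
  filter_upwards [hρ] with t h1
  field_simp

/-- A sum of `d` terms exceeding `s` has a term exceeding `s / d`; the union bound costs the factor
`d ^ α`. -/
theorem exists_sum_tail_bound (hα : 0 < α) (hK : ∀ j, 0 < K j)
    (hPareto : ∀ j, (fun t : ℝ≥0 => P.real {ω | t < V ω j}) ~[atTop]
      (fun t : ℝ≥0 => K j * (t : ℝ) ^ (-α))) :
    ∃ C : ℝ, 0 ≤ C ∧ ∀ s : ℝ≥0, 0 < s → P.real {ω | s < ∑ j, V ω j} ≤ C * (s : ℝ) ^ (-α) := by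
  choose C hC0 hC using fun j => exists_tail_bound hα (hK j) (hPareto j)
  refine ⟨∑ j, C j * ((d : ℝ) ^ α),
    Finset.sum_nonneg fun j _ => mul_nonneg (hC0 j) (by positivity), fun s hs => ?_⟩
  have hs' : (0 : ℝ) < s := hs
  rcases Nat.eq_zero_or_pos d with rfl | hd
  · simp
  have hd' : (0 : ℝ≥0) < d := by exact_mod_cast hd
  have hsub : {ω | s < ∑ j, V ω j} ⊆ ⋃ j ∈ Finset.univ, {ω | s / d < V ω j} := by
    intro ω hω
    simp only [Finset.mem_univ, Set.iUnion_true, Set.mem_iUnion, Set.mem_ofPred_eq]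
    by_contra! H
    refine absurd (show s < ∑ j, V ω j from hω) (not_lt.2 ?_)
    calc ∑ j, V ω j ≤ ∑ _j : Fin d, s / d := Finset.sum_le_sum fun j _ => H j
      _ = s := by simp; field_simp
  calc P.real {ω | s < ∑ j, V ω j} ≤ ∑ j, P.real {ω | s / d < V ω j} :=
        (measureReal_mono hsub (measure_ne_top _ _)).trans (measureReal_biUnion_finset_le _ _)
    _ ≤ ∑ j, C j * ((s / d : ℝ≥0) : ℝ) ^ (-α) :=
        Finset.sum_le_sum fun j _ => hC j _ (by positivity)
    _ = _ := by
        rw [Finset.sum_mul]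
        refine Finset.sum_congr rfl fun j _ => ?_
        have hd'' : (0 : ℝ) < d := by exact_mod_cast hd
        push_cast
        rw [Real.div_rpow hs'.le hd''.le, Real.rpow_neg hd''.le, div_inv_eq_mul]
        ring

/-- The finite part of a point of `[0,∞]^d \ {0}`. -/
def ExtOrthant.toOrthant (x : ExtOrthant d) : Fin d → ℝ≥0 := fun j => (x.1 j).toNNReal

theorem ExtOrthant.measurable_toOrthant : Measurable (ExtOrthant.toOrthant (d := d)) :=
  measurable_pi_lambda _ fun j =>
    ((measurable_pi_apply j).comp measurable_subtype_coe).ennreal_toNNReal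

theorem continuous_min_toNNReal (R : ℝ≥0) : Continuous fun y : ℝ≥0∞ => (min y R).toNNReal := by
  have h : Continuous fun y : ℝ≥0∞ => min y R := continuous_id.min continuous_const
  refine continuous_iff_continuousAt.2 fun y => ?_
  exact (ENNReal.tendsto_toNNReal
    (ne_top_of_le_ne_top ENNReal.coe_ne_top (min_le_right _ _))).comp h.continuousAt

theorem ramp_sum_eq_zero {s : ℝ≥0} (x : Fin d → ℝ≥0∞) (hx : ∑ i, x i ≤ s) :
    ramp ((s : ℝ≥0∞)⁻¹ * ∑ j, x j) = 0 := by
  refine ramp_eq_zero ?_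
  calc (s : ℝ≥0∞)⁻¹ * ∑ j, x j ≤ (s : ℝ≥0∞)⁻¹ * s := by gcongr
    _ ≤ 1 := ENNReal.inv_mul_le_one _

theorem continuous_ramp_sum {s : ℝ≥0} (hs : 0 < s) :
    Continuous fun x : Fin d → ℝ≥0∞ => ramp ((s : ℝ≥0∞)⁻¹ * ∑ j, x j) :=
  continuous_ramp.comp ((ENNReal.continuous_const_mul (by simp [hs.ne'])).comp (by fun_prop))

theorem lt_sum_smul_iff {n : ℕ} {s t : ℝ≥0} (ht : 0 < t) (x : Fin n → ℝ≥0) :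
    s < ∑ j, (t⁻¹ • x) j ↔ s * t < ∑ j, x j := by
  simp only [Pi.smul_apply, smul_eq_mul, ← Finset.mul_sum]
  rw [← div_eq_inv_mul, lt_div_iff₀ ht]

theorem rpow_mul_mul_rpow_neg {s t : ℝ≥0} (ht : 0 < t) (C : ℝ) :
    (t : ℝ) ^ α * (C * ((s * t : ℝ≥0) : ℝ) ^ (-α)) = C * (s : ℝ) ^ (-α) := by
  have ht' : (0 : ℝ) < t := ht
  have : (0 : ℝ) < (t : ℝ) ^ α := by positivity
  rw [NNReal.coe_mul, Real.mul_rpow s.coe_nonneg ht'.le, Real.rpow_neg ht'.le]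
  field_simp

/-- A bounded continuous `φ` on `ℝ₊^d` need not extend continuously to infinite coordinates, so the
vague limit is applied to `φ` with coordinates capped. The cap changes something only on a far tail,
which is small uniformly in `t` by the tail bound, and in the limit because `μ` does not charge
infinity. -/
theorem IsRegularlyVarying.exists_tailLimit (hRV : IsRegularlyVarying P N V μ)
    (hV : Measurable V) (hα : 0 < α) (hK : ∀ j, 0 < K j)
    (hPareto : ∀ j, (fun t : ℝ≥0 => P.real {ω | t < V ω j}) ~[atTop]
      (fun t : ℝ≥0 => K j * (t : ℝ) ^ (-α))) :
    ∃ c : ℝ≥0, 0 < c ∧ TailLimit P V α (c • μ.map ExtOrthant.toOrthant) := by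
  have := hRV.radon
  obtain ⟨c, hc, hlim⟩ := hRV.exists_tendsto_rpow_mul hV hα hK hPareto
  obtain ⟨C, hC0, hC⟩ := exists_sum_tail_bound hα hK hPareto
  have hτ := ExtOrthant.measurable_toOrthant (d := d)
  lift c to ℝ≥0 using hc.le
  refine ⟨c, hc, ⟨C, hC0, hC⟩, ⟨C * 2 ^ α, by positivity, fun s hs => ?_⟩, ?_⟩
  -- The limit measure inherits the bound through a `ramp` at scale `s / 2`, which vanishes up to
  -- sum `s / 2` and is `1` from sum `s` on; halving the scale is the source of `2 ^ α`.
  · have hs' : (0 : ℝ) < s := hs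
    have hs2 : 0 < s / 2 := by positivity
    have hlim1 := hlim _ (s / 2 : ℝ≥0) (continuous_ramp_sum hs2) (by exact_mod_cast hs2)
      ramp_sum_eq_zero
    have hint := hRV.integrable (continuous_ramp_sum hs2) (ε := (s / 2 : ℝ≥0))
      (by exact_mod_cast hs2) ramp_sum_eq_zero
    have hle : c * ∫ x, ramp (((s / 2 : ℝ≥0) : ℝ≥0∞)⁻¹ * ∑ j, x.1 j) ∂μ ≤
        C * 2 ^ α * (s : ℝ) ^ (-α) := by
      refine le_of_tendsto hlim1 ?_
      filter_upwards [eventually_gt_atTop 0] with t ht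
      have hB : MeasurableSet {ω | s / 2 * t < ∑ j, V ω j} :=
        measurableSet_lt measurable_const (by fun_prop)
      calc _ ≤ (t : ℝ) ^ α * (1 * P.real {ω | s / 2 * t < ∑ j, V ω j}) := by
            refine mul_le_mul_of_nonneg_left ?_ (by positivity)
            refine integral_le_measureReal hB (fun _ => ramp_nonneg _) (fun _ _ => ramp_le_one _)
              fun ω hω => ramp_sum_eq_zero _ ?_
            rw [Set.mem_ofPred_eq, ← lt_sum_smul_iff ht, not_lt] at hω
            exact_mod_cast hω
        _ ≤ (t : ℝ) ^ α * (C * ((s / 2 * t : ℝ≥0) : ℝ) ^ (-α)) := by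
            rw [one_mul]
            exact mul_le_mul_of_nonneg_left (hC _ (by positivity)) (by positivity)
        _ = _ := by
            rw [rpow_mul_mul_rpow_neg ht]
            push_cast
            rw [Real.div_rpow hs'.le zero_le_two, Real.rpow_neg zero_le_two, div_inv_eq_mul]
            ring
    have hms : MeasurableSet {x : Fin d → ℝ≥0 | s < ∑ j, x j} :=
      measurableSet_lt measurable_const (by fun_prop)
    rw [Measure.smul_apply, Measure.map_apply hτ hms]
    calc c • μ (ExtOrthant.toOrthant ⁻¹' {x | s < ∑ j, x j})
        ≤ c • ENNReal.ofReal (∫ x, ramp (((s / 2 : ℝ≥0) : ℝ≥0∞)⁻¹ * ∑ j, x.1 j) ∂μ) := by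
          gcongr
          refine measure_le_ofReal_integral hint (fun _ => ramp_nonneg _) fun x hx => ?_
          refine (ramp_eq_one ?_).ge
          -- `toOrthant` sends infinite coordinates to `0`, which can only lower the sum.
          have h1 : (s : ℝ≥0∞) ≤ ∑ j, x.1 j := by
            calc (s : ℝ≥0∞) ≤ ((∑ j, ExtOrthant.toOrthant x j : ℝ≥0) : ℝ≥0∞) := by
                  exact_mod_cast (le_of_lt hx)
              _ = ∑ j, (ExtOrthant.toOrthant x j : ℝ≥0∞) := by push_cast; rfl
              _ ≤ _ := Finset.sum_le_sum fun j _ => ENNReal.coe_toNNReal_le_self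
          calc (2 : ℝ≥0∞) = ((s / 2 : ℝ≥0) : ℝ≥0∞)⁻¹ * s := by
                rw [← ENNReal.coe_inv hs2.ne', ← ENNReal.coe_mul]
                have : (s / 2)⁻¹ * s = 2 := by field_simp
                rw [this]; rfl
            _ ≤ _ := by gcongr
      _ ≤ _ := by
          rw [ENNReal.smul_def, smul_eq_mul, ← ENNReal.ofReal_coe_nnreal,
            ← ENNReal.ofReal_mul c.coe_nonneg]
          exact ENNReal.ofReal_le_ofReal hle
  · intro φ ε hε h0
    have hε' : (0 : ℝ≥0∞) < ε := by exact_mod_cast hε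
    let Ψ : ℕ → (Fin d → ℝ≥0∞) → ℝ := fun n x => φ fun j => (min (x j) (n + 1 : ℝ≥0)).toNNReal
    have hΨ : ∀ n, Continuous (Ψ n) := fun n =>
      φ.continuous.comp (continuous_pi fun j => (continuous_min_toNNReal (n + 1)).comp
        (continuous_apply j))
    have hΨ0 : ∀ n x, ∑ j, x j ≤ (ε : ℝ≥0∞) → Ψ n x = 0 := by
      intro n x hx
      refine h0 _ ?_
      rw [← ENNReal.coe_le_coe]
      push_cast
      refine (Finset.sum_le_sum fun j _ => ?_).trans hx
      exact ENNReal.coe_toNNReal_le_self.trans (min_le_left _ _)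
    have hfin : ∀ (n : ℕ) (x : Fin d → ℝ≥0), ∑ j, x j ≤ n + 1 → Ψ n (fun j => x j) = φ x := by
      intro n x hx
      refine congrArg φ (funext fun j => ?_)
      have : x j ≤ n + 1 := (Finset.single_le_sum (f := x) (fun _ _ => zero_le)
        (Finset.mem_univ j)).trans hx
      simp only []
      rw [min_eq_left (ENNReal.coe_le_coe.2 this), ENNReal.toNNReal_coe]
    have hlimit : ∫ x, φ x ∂(c • μ.map ExtOrthant.toOrthant) =
        c * ∫ x, φ (ExtOrthant.toOrthant x) ∂μ := by
      rw [integral_smul_nnreal_measure, integral_map hτ.aemeasurable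
        φ.continuous.aestronglyMeasurable]
      rfl
    rw [hlimit]
    refine tendsto_of_approx
      (G := fun n (t : ℝ≥0) => (t : ℝ) ^ α * ∫ ω, Ψ n (fun j => (((t⁻¹ • V ω) j : ℝ≥0) : ℝ≥0∞)) ∂P)
      (L := fun n => c * ∫ x, Ψ n x.1 ∂μ)
      (E := fun n _ => 2 * ‖φ‖ * C * ((n + 1 : ℝ≥0) : ℝ) ^ (-α))
      (e := fun n => 2 * ‖φ‖ * C * ((n + 1 : ℝ≥0) : ℝ) ^ (-α))
      (fun n => hlim (Ψ n) ε (hΨ n) hε' (hΨ0 n)) ?_ (fun n => tendsto_const_nhds) ?_ fun n => ?_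
    -- All capped functions vanish up to sum `ε`, hence are dominated by `‖φ‖` times the `ramp` that
    -- reaches `1` at sum `ε`.
    · refine Tendsto.const_mul _ ?_
      have hε2 : 0 < ε / 2 := by positivity
      have hint := hRV.integrable (continuous_ramp_sum hε2) (ε := (ε / 2 : ℝ≥0))
        (by exact_mod_cast hε2) ramp_sum_eq_zero
      refine tendsto_integral_filter_of_dominated_convergence _
        (Eventually.of_forall fun n =>
          ((hΨ n).comp continuous_subtype_val).aestronglyMeasurable)
        (Eventually.of_forall fun n => ae_of_all _ fun x => ?_) (hint.const_mul ‖φ‖) ?_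
      · rcases le_total (∑ j, x.1 j) ε with h | h
        · rw [hΨ0 n _ h, norm_zero]
          exact mul_nonneg (norm_nonneg _) (ramp_nonneg _)
        · rw [ramp_eq_one, mul_one]
          · exact φ.norm_coe_le_norm _
          · calc (2 : ℝ≥0∞) = ((ε / 2 : ℝ≥0) : ℝ≥0∞)⁻¹ * ε := by
                  rw [← ENNReal.coe_inv hε2.ne', ← ENNReal.coe_mul]
                  have : (ε / 2)⁻¹ * ε = 2 := by field_simp
                  rw [this]; rfl
              _ ≤ _ := by gcongr
      · have hfinite : ∀ᵐ x ∂μ, ¬ ∃ j, x.1 j = ∞ := measure_eq_zero_iff_ae_notMem.1 hRV.infinity_null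
        filter_upwards [hfinite] with x hx
        have e : x.1 = fun j => (ExtOrthant.toOrthant x j : ℝ≥0∞) := funext fun j =>
          (ENNReal.coe_toNNReal fun h => hx ⟨j, h⟩).symm
        obtain ⟨m, hm⟩ := exists_nat_ge (∑ j, ExtOrthant.toOrthant x j)
        refine tendsto_const_nhds.congr' ?_
        filter_upwards [eventually_ge_atTop m] with n hn
        rw [e, hfin]
        refine hm.trans ?_
        have : (m : ℝ≥0) ≤ n := by exact_mod_cast hn
        exact this.trans le_self_add
    · have h1 : Tendsto (fun n : ℕ => ((n + 1 : ℝ≥0) : ℝ)) atTop atTop := by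
        push_cast
        exact tendsto_atTop_add_const_right _ _ tendsto_natCast_atTop_atTop
      simpa using ((tendsto_rpow_neg_atTop hα).comp h1).const_mul (2 * ‖φ‖ * C)
    · filter_upwards [eventually_gt_atTop 0] with t ht
      have hms : MeasurableSet {ω | ((n : ℝ≥0) + 1) * t < ∑ j, V ω j} :=
        measurableSet_lt measurable_const (by fun_prop)
      have hVt : Measurable fun ω => t⁻¹ • V ω := by fun_prop
      have i1 : Integrable (fun ω => φ (t⁻¹ • V ω)) P :=
        Integrable.of_bound (φ.continuous.measurable.comp hVt).aestronglyMeasurable ‖φ‖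
          (ae_of_all _ fun _ => φ.norm_coe_le_norm _)
      have i2 : Integrable (fun ω => Ψ n (fun j => (((t⁻¹ • V ω) j : ℝ≥0) : ℝ≥0∞))) P :=
        Integrable.of_bound ((hΨ n).measurable.comp (by fun_prop)).aestronglyMeasurable ‖φ‖
          (ae_of_all _ fun _ => φ.norm_coe_le_norm _)
      rw [← mul_sub, ← integral_sub i1 i2, abs_mul, abs_of_nonneg (by positivity)]
      calc _ ≤ (t : ℝ) ^ α * (2 * ‖φ‖ * P.real {ω | ((n : ℝ≥0) + 1) * t < ∑ j, V ω j}) := by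
            refine mul_le_mul_of_nonneg_left ?_ (by positivity)
            refine (abs_integral_le_integral_abs).trans
              (integral_le_measureReal hms (fun _ => abs_nonneg _) (fun ω _ => ?_) fun ω hω => ?_)
            · calc _ ≤ ‖φ (t⁻¹ • V ω)‖ + ‖Ψ n (fun j => (((t⁻¹ • V ω) j : ℝ≥0) : ℝ≥0∞))‖ :=
                    norm_sub_le _ _
                _ ≤ ‖φ‖ + ‖φ‖ := add_le_add (φ.norm_coe_le_norm _) (φ.norm_coe_le_norm _)
                _ = _ := by ring
            · rw [Set.mem_ofPred_eq, ← lt_sum_smul_iff ht, not_lt] at hω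
              rw [hfin n _ hω, sub_self, abs_zero]
        _ ≤ (t : ℝ) ^ α * (2 * ‖φ‖ * (C * ((((n : ℝ≥0) + 1) * t : ℝ≥0) : ℝ) ^ (-α))) := by
            gcongr
            exact hC _ (by positivity)
        _ = _ := by
            rw [mul_left_comm, rpow_mul_mul_rpow_neg ht]
            ring

end RegularVariation

/-! ### Breiman's lemma for random matrices -/

section Breiman

variable {Ω : Type*} [MeasurableSpace Ω] {P : Measure Ω} {α : ℝ} {q d : ℕ}

theorem measurableSet_lt_sum {n : ℕ} (s : ℝ≥0) :
    MeasurableSet {x : Fin n → ℝ≥0 | s < ∑ j, x j} :=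
  measurableSet_lt measurable_const (by fun_prop)

theorem integrable_of_limit_tail {n : ℕ} {ν : Measure (Fin n → ℝ≥0)} {C : ℝ}
    (hC : ∀ s : ℝ≥0, 0 < s → ν {x | s < ∑ j, x j} ≤ ENNReal.ofReal (C * (s : ℝ) ^ (-α)))
    {φ : (Fin n → ℝ≥0) → ℝ} (hφ : Measurable φ) {b : ℝ} (hb : ∀ x, |φ x| ≤ b) {ε : ℝ≥0}
    (hε : 0 < ε) (h0 : ∀ x, ∑ j, x j ≤ ε → φ x = 0) : Integrable φ ν := by
  have h : IntegrableOn φ {x | ε < ∑ j, x j} ν :=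
    Measure.integrableOn_of_bounded ((hC ε hε).trans_lt ENNReal.ofReal_lt_top).ne
      hφ.aestronglyMeasurable (ae_of_all _ hb)
  rwa [integrableOn_iff_integrable_of_support_subset] at h
  intro x hx
  by_contra hx'
  exact hx (h0 x (not_lt.1 hx'))

theorem sum_mulVec_le (B : Matrix (Fin q) (Fin d) ℝ≥0) (x : Fin d → ℝ≥0) :
    ∑ i, (B *ᵥ x) i ≤ (∑ i, ∑ j, B i j) * ∑ j, x j := by
  rw [Finset.sum_mul]
  refine Finset.sum_le_sum fun i _ => ?_
  rw [Matrix.mulVec, dotProduct, Finset.sum_mul]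
  refine Finset.sum_le_sum fun j _ => ?_
  gcongr
  exact Finset.single_le_sum (f := x) (fun _ _ => zero_le) (Finset.mem_univ j)

theorem lt_sum_mulVec {B : Matrix (Fin q) (Fin d) ℝ≥0} {x : Fin d → ℝ≥0} {s : ℝ≥0}
    (h : s < ∑ i, (B *ᵥ x) i) :
    0 < ∑ i, ∑ j, B i j ∧ s / (∑ i, ∑ j, B i j) < ∑ j, x j := by
  have h1 := h.trans_le (sum_mulVec_le B x)
  have h2 : 0 < ∑ i, ∑ j, B i j := by
    rw [pos_iff_ne_zero]
    intro h0
    simp [h0] at h1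
  exact ⟨h2, by rwa [div_lt_iff₀ h2, mul_comm]⟩

/-- `B` enlarges the coordinate sum at most by its entry sum, so the threshold is divided by that
number and the bound gains its `α`-th power. The general `Y` covers both `V` under `P` and the
identity under the limit measure. -/
theorem tail_mulVec {X : Type*} [MeasurableSpace X] {ν : Measure X} {Y : X → Fin d → ℝ≥0} {C : ℝ}
    (hC : ∀ s : ℝ≥0, 0 < s → ν {x | s < ∑ j, Y x j} ≤ ENNReal.ofReal (C * (s : ℝ) ^ (-α)))
    (B : Matrix (Fin q) (Fin d) ℝ≥0) {s : ℝ≥0} (hs : 0 < s) :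
    ν {x | s < ∑ i, (B *ᵥ Y x) i} ≤
      ENNReal.ofReal (C * (s : ℝ) ^ (-α) * ((∑ i, ∑ j, B i j : ℝ≥0) : ℝ) ^ α) := by
  rcases eq_or_ne (∑ i, ∑ j, B i j) 0 with h0 | h0
  · have : {x | s < ∑ i, (B *ᵥ Y x) i} = ∅ := by
      ext x
      simp only [Set.mem_ofPred_eq, Set.mem_empty_iff_false, iff_false]
      exact fun h => (lt_sum_mulVec h).1.ne' h0
    rw [this, measure_empty]
    exact zero_le
  · have hpos : 0 < ∑ i, ∑ j, B i j := pos_iff_ne_zero.2 h0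
    refine (measure_mono fun x hx => (lt_sum_mulVec hx).2).trans ((hC _ (by positivity)).trans ?_)
    refine ENNReal.ofReal_le_ofReal (le_of_eq ?_)
    rw [NNReal.coe_div, Real.div_rpow s.coe_nonneg (NNReal.coe_nonneg _),
      Real.rpow_neg (NNReal.coe_nonneg (∑ i, ∑ j, B i j)), div_inv_eq_mul]
    ring

theorem measurable_mulVec {X : Type*} [MeasurableSpace X] {A : X → Matrix (Fin q) (Fin d) ℝ≥0}
    {Y : X → Fin d → ℝ≥0} (hA : Measurable A) (hY : Measurable Y) :
    Measurable fun x => A x *ᵥ Y x := by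
  have hA' : ∀ i j, Measurable fun x => A x i j := fun i j =>
    (measurable_pi_apply j).comp ((measurable_pi_apply i).comp hA)
  refine measurable_pi_lambda _ fun i => ?_
  simp only [Matrix.mulVec, dotProduct]
  fun_prop

theorem measurable_sum_entries {X : Type*} [MeasurableSpace X]
    {A : X → Matrix (Fin q) (Fin d) ℝ≥0} (hA : Measurable A) :
    Measurable fun x => ∑ i, ∑ j, A x i j :=
  Finset.measurable_sum _ fun i _ => Finset.measurable_sum _ fun j _ =>
    (measurable_pi_apply j).comp ((measurable_pi_apply i).comp hA)

/-- Independence makes the joint law a product, so `A` and `V` may be evaluated at two independent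
sample points and `A` frozen. -/
theorem integral_mulVec_of_indepFun [IsProbabilityMeasure P]
    {A : Ω → Matrix (Fin q) (Fin d) ℝ≥0} {V : Ω → Fin d → ℝ≥0} (hA : Measurable A)
    (hV : Measurable V) (hind : IndepFun A V P) {f : (Fin q → ℝ≥0) → ℝ} (hf : Measurable f)
    {b : ℝ} (hb : ∀ x, |f x| ≤ b) :
    Integrable (fun ω => ∫ ω', f (A ω *ᵥ V ω') ∂P) P ∧
    ∫ ω, f (A ω *ᵥ V ω) ∂P = ∫ ω, ∫ ω', f (A ω *ᵥ V ω') ∂P ∂P := by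
  have h1 : Measurable fun p : Matrix (Fin q) (Fin d) ℝ≥0 × (Fin d → ℝ≥0) => f (p.1 *ᵥ p.2) :=
    hf.comp (measurable_mulVec measurable_fst measurable_snd)
  have h2 : Measurable fun p : Ω × Ω => f (A p.1 *ᵥ V p.2) :=
    hf.comp (measurable_mulVec (hA.comp measurable_fst) (hV.comp measurable_snd))
  have h3 : Integrable (fun p : Ω × Ω => f (A p.1 *ᵥ V p.2)) (P.prod P) :=
    Integrable.of_bound h2.aestronglyMeasurable b (ae_of_all _ fun _ => hb _)
  refine ⟨h3.integral_prod_left, ?_⟩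
  rw [← integral_prod _ h3]
  have h4 := (indepFun_iff_map_prod_eq_prod_map_map hA.aemeasurable hV.aemeasurable).1 hind
  rw [Measure.map_prod_map P P hA hV] at h4
  have h5 := congrArg (fun m => ∫ p, f (p.1 *ᵥ p.2) ∂m) h4
  rwa [integral_map (hA.prodMk hV).aemeasurable h1.aestronglyMeasurable,
    integral_map (hA.prodMap hV).aemeasurable h1.aestronglyMeasurable] at h5

theorem TailLimit.tail_measure [IsProbabilityMeasure P] {V : Ω → Fin d → ℝ≥0}
    {ν : Measure (Fin d → ℝ≥0)} (h : TailLimit P V α ν) :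
    ∃ C : ℝ, 0 ≤ C ∧ ∀ s : ℝ≥0, 0 < s →
      P {ω | s < ∑ j, V ω j} ≤ ENNReal.ofReal (C * (s : ℝ) ^ (-α)) := by
  obtain ⟨C, hC0, hC⟩ := h.tail
  refine ⟨C, hC0, fun s hs => ?_⟩
  rw [← ofReal_measureReal]
  exact ENNReal.ofReal_le_ofReal (hC s hs)

/-- Breiman's lemma: a random linear map which is independent of `V` and has a moment of order `α`
preserves the existence of a tail limit. -/
theorem TailLimit.mulVec [IsProbabilityMeasure P] {V : Ω → Fin d → ℝ≥0}
    {ν : Measure (Fin d → ℝ≥0)} [SFinite ν] (h : TailLimit P V α ν)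
    (hV : Measurable V) {A : Ω → Matrix (Fin q) (Fin d) ℝ≥0} (hA : Measurable A)
    (hind : IndepFun A V P)
    (hmom : Integrable (fun ω => ((∑ i, ∑ j, A ω i j : ℝ≥0) : ℝ) ^ α) P) :
    TailLimit P (fun ω => A ω *ᵥ V ω) α ((P.prod ν).map fun p => A p.1 *ᵥ p.2) := by
  have hm : Measurable fun p : Ω × (Fin d → ℝ≥0) => A p.1 *ᵥ p.2 :=
    measurable_mulVec (hA.comp measurable_fst) measurable_snd
  have hmean : 0 ≤ ∫ ω, ((∑ i, ∑ j, A ω i j : ℝ≥0) : ℝ) ^ α ∂P :=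
    integral_nonneg fun ω => by positivity
  obtain ⟨C, hC0, hC⟩ := h.tail_measure
  have hCr : ∀ (B : Matrix (Fin q) (Fin d) ℝ≥0) (s : ℝ≥0), 0 < s →
      P.real {ω | s < ∑ i, (B *ᵥ V ω) i} ≤
        C * (s : ℝ) ^ (-α) * ((∑ i, ∑ j, B i j : ℝ≥0) : ℝ) ^ α := fun B s hs =>
    ENNReal.toReal_le_of_le_ofReal (by positivity) (tail_mulVec hC B hs)
  obtain ⟨D, hD0, hD⟩ := h.limit_tail
  have hlt : ∀ s : ℝ≥0, 0 < s → ((P.prod ν).map fun p => A p.1 *ᵥ p.2) {x | s < ∑ j, x j} ≤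
      ENNReal.ofReal ((D * ∫ ω, ((∑ i, ∑ j, A ω i j : ℝ≥0) : ℝ) ^ α ∂P) * (s : ℝ) ^ (-α)) := by
    intro s hs
    rw [Measure.map_apply hm (measurableSet_lt_sum s),
      Measure.prod_apply (hm (measurableSet_lt_sum s))]
    calc _ ≤ ∫⁻ ω, ENNReal.ofReal
          (D * (s : ℝ) ^ (-α) * ((∑ i, ∑ j, A ω i j : ℝ≥0) : ℝ) ^ α) ∂P :=
          lintegral_mono fun ω => tail_mulVec (Y := id) hD (A ω) hs
      _ = _ := by
          rw [← ofReal_integral_eq_lintegral_ofReal (hmom.const_mul _)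
            (ae_of_all _ fun ω => by positivity), integral_const_mul]
          congr 1
          ring
  refine ⟨⟨C * ∫ ω, ((∑ i, ∑ j, A ω i j : ℝ≥0) : ℝ) ^ α ∂P, by positivity, fun s hs => ?_⟩,
    ⟨D * ∫ ω, ((∑ i, ∑ j, A ω i j : ℝ≥0) : ℝ) ^ α ∂P, by positivity, hlt⟩, ?_⟩
  · have hind1 : Measurable ({x : Fin q → ℝ≥0 | s < ∑ j, x j}.indicator (1 : (Fin q → ℝ≥0) → ℝ)) :=
      measurable_one.indicator (measurableSet_lt_sum s)
    have hconv : ∀ {Y : Ω → Fin q → ℝ≥0}, Measurable Y →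
        ∫ ω, {x : Fin q → ℝ≥0 | s < ∑ j, x j}.indicator (1 : (Fin q → ℝ≥0) → ℝ) (Y ω) ∂P =
          P.real {ω | s < ∑ j, Y ω j} := fun {Y} hY =>
      integral_indicator_one (hY (measurableSet_lt_sum s))
    obtain ⟨i1, i2⟩ := integral_mulVec_of_indepFun hA hV hind hind1 (b := 1) fun x => by
      by_cases hx : x ∈ {x : Fin q → ℝ≥0 | s < ∑ j, x j}
      · rw [Set.indicator_of_mem hx]; simp
      · rw [Set.indicator_of_notMem hx]; simp
    rw [hconv (measurable_mulVec hA hV)] at i2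
    rw [i2]
    calc _ ≤ ∫ ω, C * (s : ℝ) ^ (-α) * ((∑ i, ∑ j, A ω i j : ℝ≥0) : ℝ) ^ α ∂P := by
          refine integral_mono i1 (hmom.const_mul _) fun ω => ?_
          simp only []
          rw [hconv (measurable_mulVec measurable_const hV)]
          exact hCr (A ω) s hs
      _ = _ := by
          rw [integral_const_mul]
          ring
  · intro φ ε hε h0
    have hφm : ∀ t : ℝ≥0, Measurable fun x : Fin q → ℝ≥0 => φ (t⁻¹ • x) := fun t =>
      φ.continuous.measurable.comp (by fun_prop)
    have hfub := fun t : ℝ≥0 => integral_mulVec_of_indepFun hA hV hind (hφm t)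
      (fun x => φ.norm_coe_le_norm (t⁻¹ • x))
    have hint : Integrable φ ((P.prod ν).map fun p => A p.1 *ᵥ p.2) :=
      integrable_of_limit_tail hlt φ.continuous.measurable φ.norm_coe_le_norm hε h0
    have hlimit : ∫ x, φ x ∂((P.prod ν).map fun p => A p.1 *ᵥ p.2) =
        ∫ ω, ∫ x, φ (A ω *ᵥ x) ∂ν ∂P := by
      rw [integral_map hm.aemeasurable φ.continuous.aestronglyMeasurable, integral_prod]
      exact (integrable_map_measure φ.continuous.aestronglyMeasurable hm.aemeasurable).1 hint
    rw [hlimit]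
    have e : ∀ t : ℝ≥0, (t : ℝ) ^ α * ∫ ω, φ (t⁻¹ • A ω *ᵥ V ω) ∂P =
        ∫ ω, (t : ℝ) ^ α * ∫ ω', φ (t⁻¹ • A ω *ᵥ V ω') ∂P ∂P := fun t => by
      rw [(hfub t).2, integral_const_mul]
    simp_rw [e]
    -- With `A ω` frozen, convergence is the tail limit of `V`. Since `φ` vanishes up to sum `ε`,
    -- only the tail of `A ω *ᵥ V` past `ε * t` contributes, which gives the dominating function.
    refine tendsto_integral_filter_of_dominated_convergence
      (fun ω => ‖φ‖ * (C * (ε : ℝ) ^ (-α)) * ((∑ i, ∑ j, A ω i j : ℝ≥0) : ℝ) ^ α)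
      (Eventually.of_forall fun t => ((hfub t).1.const_mul _).1) ?_ (hmom.const_mul _)
      (ae_of_all _ fun ω => ?_)
    · filter_upwards [eventually_gt_atTop 0] with t ht
      refine ae_of_all _ fun ω => ?_
      have hms : MeasurableSet {ω' | ε * t < ∑ i, (A ω *ᵥ V ω') i} :=
        measurable_mulVec measurable_const hV (measurableSet_lt_sum _)
      calc ‖(t : ℝ) ^ α * ∫ ω', φ (t⁻¹ • A ω *ᵥ V ω') ∂P‖
          ≤ (t : ℝ) ^ α * (‖φ‖ * P.real {ω' | ε * t < ∑ i, (A ω *ᵥ V ω') i}) := by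
            rw [norm_mul, Real.norm_of_nonneg (by positivity)]
            refine mul_le_mul_of_nonneg_left ?_ (by positivity)
            refine (norm_integral_le_integral_norm _).trans
              (integral_le_measureReal hms (fun _ => norm_nonneg _)
                (fun _ _ => φ.norm_coe_le_norm _) fun ω' hω' => ?_)
            rw [Set.mem_ofPred_eq, ← lt_sum_smul_iff ht, not_lt] at hω'
            rw [h0 _ hω', norm_zero]
        _ ≤ (t : ℝ) ^ α * (‖φ‖ * (C * ((ε * t : ℝ≥0) : ℝ) ^ (-α) *
              ((∑ i, ∑ j, A ω i j : ℝ≥0) : ℝ) ^ α)) := by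
            gcongr
            exact hCr (A ω) _ (by positivity)
        _ = ‖φ‖ * ((t : ℝ) ^ α * (C * ((ε * t : ℝ≥0) : ℝ) ^ (-α))) *
              ((∑ i, ∑ j, A ω i j : ℝ≥0) : ℝ) ^ α := by ring
        _ = _ := by rw [rpow_mul_mul_rpow_neg ht]
    · have hcont : Continuous fun x : Fin d → ℝ≥0 => A ω *ᵥ x :=
        continuous_pi fun i => by simp only [Matrix.mulVec, dotProduct]; fun_prop
      -- The `+ 1` keeps the threshold meaningful when `A ω = 0`.
      have := h.tendsto (φ.compContinuous ⟨_, hcont⟩) (ε / (∑ i, ∑ j, A ω i j + 1))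
        (by positivity) fun x hx => h0 _ ?_
      · refine this.congr fun t => ?_
        simp only [BoundedContinuousFunction.compContinuous_apply, ContinuousMap.coe_mk,
          Matrix.mulVec_smul]
      · rw [le_div_iff₀ (by positivity)] at hx
        refine (sum_mulVec_le _ _).trans (le_trans ?_ hx)
        rw [mul_comm]
        gcongr
        exact le_self_add

end Breiman

/-! ### One-homogeneous functions -/

section Homogeneous

variable {q : ℕ} {k : (Fin q → ℝ≥0) → ℝ≥0}

theorem IsOneHomogeneous.map_zero (hk : IsOneHomogeneous k) : k 0 = 0 := by
  have h := hk 2 0 two_pos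
  rw [smul_zero, two_mul] at h
  simpa using h

/-- Continuity at `0` gives `k < 1` on a ball of radius `r`; rescaling any nonzero `x` to coordinate
sum `r / 2` lands in that ball. Consequently `{k > s}` stays away from `0` for `s > 0`. -/
theorem IsOneHomogeneous.exists_le_mul_sum (hk : IsOneHomogeneous k) (hc : Continuous k) :
    ∃ C : ℝ≥0, 0 < C ∧ ∀ x, k x ≤ C * ∑ j, x j := by
  have h0 : ∀ᶠ x in 𝓝 0, k x < 1 :=
    hc.continuousAt.eventually (by rw [hk.map_zero]; exact eventually_lt_nhds one_pos)
  obtain ⟨r, hr, hball⟩ := Metric.eventually_nhds_iff.1 h0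
  lift r to ℝ≥0 using hr.le
  have hr' : 0 < r := hr
  have hη : 0 < r / 2 := by positivity
  refine ⟨(r / 2)⁻¹, by positivity, fun x => ?_⟩
  rcases eq_or_ne (∑ j, x j) 0 with hx | hx
  · have : x = 0 := funext fun j => by
      have := (Finset.sum_eq_zero_iff_of_nonneg (fun _ _ => zero_le)).1 hx j (Finset.mem_univ j)
      exact this
    rw [this, hk.map_zero]
    exact zero_le
  · have hs : 0 < ∑ j, x j := pos_iff_ne_zero.2 hx
    have ha : 0 < r / 2 * (∑ j, x j)⁻¹ := by positivity
    have h1 : k ((r / 2 * (∑ j, x j)⁻¹) • x) < 1 := by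
      apply hball
      rw [dist_pi_lt_iff hr]
      intro j
      have h2 : r / 2 * (∑ j, x j)⁻¹ * x j ≤ r / 2 := by
        rw [mul_assoc]
        refine mul_le_of_le_one_right zero_le ?_
        rw [inv_mul_le_iff₀ hs, mul_one]
        exact Finset.single_le_sum (f := x) (fun _ _ => zero_le) (Finset.mem_univ j)
      have h3 : r / 2 * (∑ j, x j)⁻¹ * x j < r := h2.trans_lt (half_lt_self hr')
      rw [NNReal.dist_eq, Pi.zero_apply, NNReal.coe_zero, sub_zero, NNReal.abs_eq]
      exact_mod_cast h3
    rw [hk _ _ ha, mul_assoc, ← div_eq_inv_mul] at h1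
    have h4 := h1.le
    rw [← le_div_iff₀' hη, div_le_iff₀ hs] at h4
    rwa [one_div] at h4

theorem lt_div_of_lt {C s : ℝ≥0} (hC : 0 < C) {x : Fin q → ℝ≥0} (h : k x ≤ C * ∑ j, x j)
    (hs : s < k x) : s / C < ∑ j, x j := by
  rw [div_lt_iff₀' hC]
  exact hs.trans_le h

theorem IsOneHomogeneous.lt_inv_smul_iff (hk : IsOneHomogeneous k) {s t : ℝ≥0} (ht : 0 < t)
    (x : Fin q → ℝ≥0) : s < k (t⁻¹ • x) ↔ s * t < k x := by
  rw [hk _ _ (inv_pos.2 ht), ← div_eq_inv_mul, lt_div_iff₀ ht]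

theorem IsOneHomogeneous.eq_zero_of_le (hk : IsOneHomogeneous k) {C : ℝ≥0} (hC : ∀ x, k x ≤ C)
    (x : Fin q → ℝ≥0) : k x = 0 := by
  by_contra h
  have hx : 0 < k x := pos_iff_ne_zero.2 h
  -- At this multiple of `x` the value of `k` is exactly `C + 1`.
  have h1 := hC (((C + 1) / k x) • x)
  rw [hk _ _ (by positivity), div_mul_cancel₀ _ h] at h1
  exact absurd h1 (not_le.2 (lt_add_one C))

/-- The nonvanishing set is a cone, so if nonempty it comes arbitrarily close to the removed origin,
while a compact subset of the punctured space keeps a positive distance from it. -/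
theorem IsOneHomogeneous.eq_zero_of_hasCompactSupport (hk : IsOneHomogeneous k)
    (hc : HasCompactSupportInExtOrthant k) (x : Fin q → ℝ≥0) : k x = 0 := by
  by_contra h
  have hx0 : x ≠ 0 := by
    rintro rfl
    exact h hk.map_zero
  have hs : 0 < ∑ j, x j := by
    rw [pos_iff_ne_zero]
    intro hs
    exact hx0 (funext fun j =>
      (Finset.sum_eq_zero_iff_of_nonneg (fun _ _ => zero_le)).1 hs j (Finset.mem_univ j))
  obtain ⟨t, ht⟩ := hc.elim_directed_cover
    (fun n : ℕ => {y : ExtOrthant q | ((n : ℝ≥0∞) + 1)⁻¹ < ∑ j, y.1 j})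
    (fun n => isOpen_lt continuous_const (by fun_prop)) (fun y _ => by
      simp only [Set.mem_iUnion, Set.mem_ofPred_eq]
      have hy : ∑ j, y.1 j ≠ 0 := by
        intro hs
        exact y.2 (funext fun j =>
          (Finset.sum_eq_zero_iff_of_nonneg (fun _ _ => zero_le)).1 hs j (Finset.mem_univ j))
      obtain ⟨n, hn⟩ := ENNReal.exists_inv_nat_lt hy
      refine ⟨n, lt_of_le_of_lt ?_ hn⟩
      simp)
    (directed_of_isDirected_le fun m n hmn y hy => lt_of_le_of_lt
      (show ((n : ℝ≥0∞) + 1)⁻¹ ≤ ((m : ℝ≥0∞) + 1)⁻¹ from ENNReal.inv_le_inv.2 (by gcongr)) hy)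
  -- The scaled point has coordinate sum exactly `1 / (t + 1)`, just missing the strict inequality
  -- defining the covering set.
  let a : ℝ≥0 := ((t : ℝ≥0) + 1)⁻¹ * (∑ j, x j)⁻¹
  have ha : 0 < a := by positivity
  have hne : (fun i => (((a • x) i : ℝ≥0) : ℝ≥0∞)) ≠ 0 := by
    intro h0
    refine hx0 (funext fun i => ?_)
    have := congrFun h0 i
    simpa [ha.ne'] using this
  have hmem := ht (subset_closure (show (⟨_, hne⟩ : ExtOrthant q) ∈
    {y : ExtOrthant q | ∃ x : Fin q → ℝ≥0, k x ≠ 0 ∧ ∀ i, y.1 i = (x i : ℝ≥0∞)} from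
      ⟨a • x, by rw [hk _ _ ha]; exact mul_ne_zero ha.ne' h, fun _ => rfl⟩))
  have hsum : ∑ j, (a • x) j = ((t : ℝ≥0) + 1)⁻¹ := by
    simp only [Pi.smul_apply, smul_eq_mul, ← Finset.mul_sum, a]
    rw [mul_assoc, inv_mul_cancel₀ hs.ne', mul_one]
  simp only [Set.mem_ofPred_eq] at hmem
  rw [← ENNReal.ofNNReal_finsetSum, hsum, ENNReal.coe_inv (by positivity)] at hmem
  push_cast at hmem
  exact lt_irrefl _ hmem

end Homogeneous

/-! ### Continuous approximations of the indicator of `(1, ∞)` -/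

section Slope

/-- The continuous function that is `0` up to `1`, linear on `[1, 1 + 1 / (n + 1)]`,
and `1` afterwards. -/
noncomputable def slope01 (n : ℕ) (y : ℝ≥0) : ℝ := max 0 (min (((n : ℝ) + 1) * ((y : ℝ) - 1)) 1)

theorem continuous_slope01 (n : ℕ) : Continuous (slope01 n) := by
  unfold slope01
  fun_prop

theorem slope01_nonneg (n : ℕ) (y : ℝ≥0) : 0 ≤ slope01 n y := le_max_left _ _

theorem slope01_le_one (n : ℕ) (y : ℝ≥0) : slope01 n y ≤ 1 :=
  max_le zero_le_one (min_le_right _ _)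

theorem slope01_eq_zero (n : ℕ) {y : ℝ≥0} (hy : y ≤ 1) : slope01 n y = 0 := by
  have hy' : (y : ℝ) ≤ 1 := hy
  refine max_eq_left (min_le_of_left_le ?_)
  exact mul_nonpos_of_nonneg_of_nonpos (by positivity) (by linarith)

theorem slope01_eq_one (n : ℕ) {y : ℝ≥0} (hy : 1 + ((n : ℝ≥0) + 1)⁻¹ ≤ y) : slope01 n y = 1 := by
  have hy' : 1 + ((n : ℝ) + 1)⁻¹ ≤ (y : ℝ) := by exact_mod_cast hy
  rw [slope01, min_eq_right, max_eq_right zero_le_one]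
  rw [← div_le_iff₀' (by positivity), one_div]
  linarith

/-- For `y > 1` the dilated argument is already where the slope equals `1`; for `y ≤ 1` the left
side is `0`. The error thus becomes the difference between a test function and its dilation, which
homogeneity of the limit can evaluate. -/
theorem abs_indicator_sub_slope01_le (n : ℕ) (y : ℝ≥0) :
    |(if 1 < y then 1 else 0) - slope01 n y| ≤
      slope01 n ((1 + ((n : ℝ≥0) + 1)⁻¹) * y) - slope01 n y := by
  split_ifs with h
  · rw [abs_of_nonneg (sub_nonneg.2 (slope01_le_one _ _)), slope01_eq_one n (y := _ * y)]
    exact le_mul_of_one_le_right zero_le h.le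
  · rw [slope01_eq_zero n (not_lt.1 h), sub_zero, abs_zero, sub_zero]
    exact slope01_nonneg _ _

theorem tendsto_slope01 (y : ℝ≥0) :
    Tendsto (fun n => slope01 n y) atTop (𝓝 (if 1 < y then 1 else 0)) := by
  split_ifs with h
  · have h' : (0 : ℝ) < y - 1 := sub_pos.2 (NNReal.coe_lt_coe.2 h)
    obtain ⟨m, hm⟩ := exists_nat_ge ((y : ℝ) - 1)⁻¹
    refine tendsto_const_nhds.congr' ?_
    filter_upwards [eventually_ge_atTop m] with n hn
    have hn' : (m : ℝ) ≤ n := by exact_mod_cast hn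
    rw [slope01, min_eq_right, max_eq_right zero_le_one]
    rw [← div_le_iff₀ h', one_div]
    linarith
  · simp_rw [slope01_eq_zero _ (not_lt.1 h)]
    exact tendsto_const_nhds

end Slope

/-! ### Homogeneity of the limit and sharp level sets -/

section TailLimit

variable {Ω : Type*} [MeasurableSpace Ω] {P : Measure Ω} [IsProbabilityMeasure P] {α : ℝ} {q : ℕ}
  {X : Ω → Fin q → ℝ≥0} {ν : Measure (Fin q → ℝ≥0)} {k : (Fin q → ℝ≥0) → ℝ≥0}

theorem measurableSet_lt_comp (hX : Measurable X) (hk : Continuous k) (s : ℝ≥0) :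
    MeasurableSet {ω | s < k (X ω)} :=
  measurableSet_lt measurable_const (hk.measurable.comp hX)

theorem TailLimit.tail_comp {P : Measure Ω} [IsFiniteMeasure P] (h : TailLimit P X α ν)
    {C : ℝ≥0} (hC : 0 < C) (hk : ∀ x, k x ≤ C * ∑ j, x j) :
    ∃ D : ℝ, 0 ≤ D ∧ ∀ s : ℝ≥0, 0 < s → P.real {ω | s < k (X ω)} ≤ D * (s : ℝ) ^ (-α) := by
  obtain ⟨D, hD0, hD⟩ := h.tail
  refine ⟨D * (C : ℝ) ^ α, by positivity, fun s hs => ?_⟩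
  have hC' : (0 : ℝ) < C := hC
  calc P.real {ω | s < k (X ω)} ≤ P.real {ω | s / C < ∑ j, X ω j} :=
        measureReal_mono (fun ω hω => lt_div_of_lt hC (hk _) hω) (measure_ne_top _ _)
    _ ≤ D * ((s / C : ℝ≥0) : ℝ) ^ (-α) := hD _ (by positivity)
    _ = _ := by
        rw [NNReal.coe_div, Real.div_rpow s.coe_nonneg hC'.le, Real.rpow_neg hC'.le, div_inv_eq_mul]
        ring

theorem TailLimit.limit_lt_top {P : Measure Ω} (h : TailLimit P X α ν)
    {C : ℝ≥0} (hC : 0 < C) (hk : ∀ x, k x ≤ C * ∑ j, x j) {s : ℝ≥0} (hs : 0 < s) :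
    ν {x | s < k x} < ∞ := by
  obtain ⟨D, -, hD⟩ := h.limit_tail
  exact ((measure_mono fun x hx => lt_div_of_lt hC (hk x) hx).trans
    (hD (s / C) (by positivity))).trans_lt ENNReal.ofReal_lt_top

/-- The limit inherits the homogeneity of order `-α`. -/
theorem TailLimit.integral_smul {P : Measure Ω} (h : TailLimit P X α ν)
    (φ : (Fin q → ℝ≥0) →ᵇ ℝ) {ε : ℝ≥0} (hε : 0 < ε) (h0 : ∀ x, ∑ j, x j ≤ ε → φ x = 0)
    {s : ℝ≥0} (hs : 0 < s) : ∫ x, φ (s • x) ∂ν = (s : ℝ) ^ α * ∫ x, φ x ∂ν := by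
  have hc : Continuous fun x : Fin q → ℝ≥0 => s • x := by fun_prop
  have h1 := h.tendsto (φ.compContinuous ⟨_, hc⟩) (s⁻¹ * ε) (by positivity) fun x hx => h0 _ (by
    simp only [ContinuousMap.coe_mk, Pi.smul_apply, smul_eq_mul, ← Finset.mul_sum]
    rwa [← le_inv_mul_iff₀ hs])
  have h2 := ((h.tendsto φ ε hε h0).comp
    (tendsto_id.const_mul_atTop (inv_pos.2 hs))).const_mul ((s : ℝ) ^ α)
  -- Dilating the test function by `s` amounts to replacing `t` by `s⁻¹ * t`, so one sequence has
  -- both limits.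
  refine tendsto_nhds_unique h1 (h2.congr fun t => ?_)
  have hs' : (0 : ℝ) < (s : ℝ) ^ α := Real.rpow_pos_of_pos hs _
  simp only [Function.comp, id, BoundedContinuousFunction.compContinuous_apply,
    ContinuousMap.coe_mk, mul_inv, inv_inv, smul_smul]
  rw [NNReal.coe_mul, Real.mul_rpow (NNReal.coe_nonneg _) (NNReal.coe_nonneg _), NNReal.coe_inv,
    Real.inv_rpow s.coe_nonneg]
  field_simp

/-- The product of a bounded continuous function with `slope01 n ∘ k`. -/
noncomputable def slopeCutoff (f : (Fin q → ℝ≥0) →ᵇ ℝ) (n : ℕ) (hk : Continuous k) :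
    (Fin q → ℝ≥0) →ᵇ ℝ :=
  BoundedContinuousFunction.ofNormedAddCommGroup (fun x => f x * slope01 n (k x))
    (f.continuous.mul ((continuous_slope01 n).comp hk)) ‖f‖ fun x => by
      rw [norm_mul, Real.norm_of_nonneg (slope01_nonneg _ _)]
      exact (mul_le_of_le_one_right (norm_nonneg _) (slope01_le_one _ _)).trans
        (f.norm_coe_le_norm x)

theorem slopeCutoff_apply (f : (Fin q → ℝ≥0) →ᵇ ℝ) (n : ℕ) (hk : Continuous k)
    (x : Fin q → ℝ≥0) : slopeCutoff f n hk x = f x * slope01 n (k x) := rfl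

theorem slopeCutoff_eq_zero (f : (Fin q → ℝ≥0) →ᵇ ℝ) (n : ℕ) (hk : Continuous k) {C : ℝ≥0}
    (hC : 0 < C) (hle : ∀ x, k x ≤ C * ∑ j, x j) (x : Fin q → ℝ≥0) (hx : ∑ j, x j ≤ C⁻¹) :
    slopeCutoff f n hk x = 0 := by
  rw [slopeCutoff_apply, slope01_eq_zero, mul_zero]
  refine (hle x).trans ?_
  calc C * ∑ j, x j ≤ C * C⁻¹ := by gcongr
    _ = 1 := mul_inv_cancel₀ hC.ne'

/-- The indicator of `{k > 1}` is replaced by `slope01 n ∘ k`. The error is at most `‖f‖` times the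
difference of the integrals of this cut-off dilated by `1 + 1 / (n + 1)` and undilated. No separate
argument that `{k = 1}` is null is needed. -/
theorem TailLimit.tendsto_setIntegral (h : TailLimit P X α ν) (hX : Measurable X)
    (hk : IsOneHomogeneous k) (hc : Continuous k) (f : (Fin q → ℝ≥0) →ᵇ ℝ) :
    Tendsto (fun t : ℝ≥0 => (t : ℝ) ^ α * ∫ ω in {ω | t < k (X ω)}, f (t⁻¹ • X ω) ∂P) atTop
      (𝓝 (∫ x in {x | 1 < k x}, f x ∂ν)) := by
  obtain ⟨C, hC, hle⟩ := hk.exists_le_mul_sum hc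
  have hCi : 0 < C⁻¹ := inv_pos.2 hC
  have hz := fun (f : (Fin q → ℝ≥0) →ᵇ ℝ) n => slopeCutoff_eq_zero f n hc hC hle
  let s : ℕ → ℝ≥0 := fun n => 1 + ((n : ℝ≥0) + 1)⁻¹
  have hs : ∀ n, 0 < s n := fun n => by positivity
  have hfin : ν {x | 1 < k x} < ∞ := h.limit_lt_top hC hle one_pos
  have hms : MeasurableSet {x | 1 < k x} := measurableSet_lt measurable_const hc.measurable
  let u : ℕ → (Fin q → ℝ≥0) →ᵇ ℝ := fun n => slopeCutoff (.const _ 1) n hc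
  have hu : ∀ n x, u n x = slope01 n (k x) := fun n x => by simp [u, slopeCutoff_apply]
  have hsc : ∀ n, Continuous fun x : Fin q → ℝ≥0 => s n • x := fun n => by fun_prop
  let us : ℕ → (Fin q → ℝ≥0) →ᵇ ℝ := fun n => (u n).compContinuous ⟨_, hsc n⟩
  have hus : ∀ n x, us n x = slope01 n (s n * k x) := fun n x => by
    rw [← hk _ _ (hs n), ← hu]; rfl
  have hus0 : ∀ n x, ∑ j, x j ≤ (s n)⁻¹ * C⁻¹ → us n x = 0 := fun n x hx => hz _ n _ (by
    simp only [ContinuousMap.coe_mk, Pi.smul_apply, smul_eq_mul, ← Finset.mul_sum]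
    rwa [← le_inv_mul_iff₀ (hs n)])
  refine tendsto_of_approx
    (G := fun n (t : ℝ≥0) => (t : ℝ) ^ α * ∫ ω, slopeCutoff f n hc (t⁻¹ • X ω) ∂P)
    (L := fun n => ∫ x, slopeCutoff f n hc x ∂ν)
    (E := fun n (t : ℝ≥0) => ‖f‖ * ((t : ℝ) ^ α * ∫ ω, us n (t⁻¹ • X ω) ∂P -
      (t : ℝ) ^ α * ∫ ω, u n (t⁻¹ • X ω) ∂P))
    (e := fun n => ‖f‖ * (∫ x, us n x ∂ν - ∫ x, u n x ∂ν))
    (fun n => h.tendsto _ _ hCi (hz f n)) ?_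
    (fun n => ((h.tendsto _ _ (by have := hs n; positivity) (hus0 n)).sub
      (h.tendsto _ _ hCi (hz _ n))).const_mul _) ?_ fun n => ?_
  · rw [← integral_indicator hms]
    refine tendsto_integral_of_dominated_convergence ({x | 1 < k x}.indicator fun _ => ‖f‖)
      (fun n => (slopeCutoff f n hc).continuous.aestronglyMeasurable)
      ((integrable_indicator_iff hms).2 (integrableOn_const hfin.ne)) (fun n => ?_) ?_
    · refine ae_of_all _ fun x => ?_
      by_cases hx : 1 < k x
      · rw [Set.indicator_of_mem (by exact hx), slopeCutoff_apply, norm_mul,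
          Real.norm_of_nonneg (slope01_nonneg _ _)]
        exact (mul_le_of_le_one_right (norm_nonneg _) (slope01_le_one _ _)).trans
          (f.norm_coe_le_norm x)
      · rw [Set.indicator_of_notMem (by exact hx), slopeCutoff_apply,
          slope01_eq_zero _ (not_lt.1 hx), mul_zero, norm_zero]
    · refine ae_of_all _ fun x => ?_
      have := (tendsto_slope01 (k x)).const_mul (f x)
      by_cases hx : 1 < k x
      · rw [Set.indicator_of_mem (by exact hx)]
        simpa [hx, slopeCutoff_apply] using this
      · rw [Set.indicator_of_notMem (by exact hx)]
        simpa [hx, slopeCutoff_apply] using this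
  · have hui : ∀ n, 0 ≤ ∫ x, u n x ∂ν ∧ ∫ x, u n x ∂ν ≤ ν.real {x | 1 < k x} := fun n => by
      refine ⟨integral_nonneg fun x => by rw [hu]; exact slope01_nonneg _ _, ?_⟩
      rw [← integral_indicator_one hms]
      refine integral_mono_of_nonneg (ae_of_all _ fun x => by rw [hu]; exact slope01_nonneg _ _)
        ((integrable_indicator_iff hms).2 (integrableOn_const hfin.ne)) (ae_of_all _ fun x => ?_)
      by_cases hx : 1 < k x
      · rw [Set.indicator_of_mem (by exact hx), hu]
        exact slope01_le_one _ _
      · rw [Set.indicator_of_notMem (by exact hx), hu, slope01_eq_zero _ (not_lt.1 hx)]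
    -- Homogeneity of order `-α` evaluates the error: a bounded integral times `(s n) ^ α - 1`,
    -- which tends to `0`.
    have hdiff : ∀ n, ∫ x, us n x ∂ν - ∫ x, u n x ∂ν = ((s n : ℝ) ^ α - 1) * ∫ x, u n x ∂ν :=
      fun n => by
        have := h.integral_smul (u n) hCi (hz _ n) (hs n)
        rw [show ∫ x, us n x ∂ν = _ from this]
        ring
    simp_rw [hdiff]
    have hs1 : Tendsto (fun n => (s n : ℝ) ^ α - 1) atTop (𝓝 0) := by
      have h1 : Tendsto (fun n => (s n : ℝ)) atTop (𝓝 1) := by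
        have := (tendsto_one_div_add_atTop_nhds_zero_nat (𝕜 := ℝ)).const_add 1
        simpa [s] using this
      have h2 := (h1.rpow_const (p := α) (Or.inl one_ne_zero)).sub_const 1
      simpa using h2
    have hb := bdd_le_mul_tendsto_zero' (f := fun n => ∫ x, u n x ∂ν) (ν.real {x | 1 < k x})
      (Eventually.of_forall fun n => by rw [abs_of_nonneg (hui n).1]; exact (hui n).2) hs1
    simpa [mul_comm] using hb.const_mul ‖f‖
  · filter_upwards [eventually_gt_atTop 0] with t ht
    have hXt : Measurable fun ω => t⁻¹ • X ω := by fun_prop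
    have hint : ∀ φ : (Fin q → ℝ≥0) →ᵇ ℝ, Integrable (fun ω => φ (t⁻¹ • X ω)) P := fun φ =>
      Integrable.of_bound (φ.continuous.measurable.comp hXt).aestronglyMeasurable ‖φ‖
        (ae_of_all _ fun _ => φ.norm_coe_le_norm _)
    have hmX := measurableSet_lt_comp hX hc t
    have hiff : ∀ ω, t < k (X ω) ↔ 1 < k (t⁻¹ • X ω) := fun ω => by
      rw [hk.lt_inv_smul_iff ht, one_mul]
    rw [← integral_indicator hmX, ← mul_sub, ← mul_sub,
      ← integral_sub ((hint f).indicator hmX) (hint _), ← integral_sub (hint _) (hint _), abs_mul,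
      abs_of_nonneg (by positivity), mul_left_comm, ← integral_const_mul]
    refine mul_le_mul_of_nonneg_left ?_ (by positivity)
    refine abs_integral_le_integral_abs.trans
      (integral_mono (((hint f).indicator hmX).sub (hint _)).abs
        (((hint _).sub (hint _)).const_mul _) fun ω => ?_)
    simp only []
    have e : {ω | t < k (X ω)}.indicator (fun ω => f (t⁻¹ • X ω)) ω =
        f (t⁻¹ • X ω) * if 1 < k (t⁻¹ • X ω) then 1 else 0 := by
      by_cases hω : t < k (X ω)
      · rw [Set.indicator_of_mem (by exact hω), if_pos ((hiff ω).1 hω), mul_one]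
      · rw [Set.indicator_of_notMem (by exact hω), if_neg (fun h => hω ((hiff ω).2 h)), mul_zero]
    rw [e, slopeCutoff_apply, ← mul_sub, abs_mul, hus, hu]
    exact mul_le_mul (f.norm_coe_le_norm _) (abs_indicator_sub_slope01_le n _) (abs_nonneg _)
      (norm_nonneg _)

theorem TailLimit.tendsto_measureReal (h : TailLimit P X α ν) (hX : Measurable X)
    (hk : IsOneHomogeneous k) (hc : Continuous k) :
    Tendsto (fun t : ℝ≥0 => (t : ℝ) ^ α * P.real {ω | t < k (X ω)}) atTop
      (𝓝 (ν.real {x | 1 < k x})) := by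
  simpa using h.tendsto_setIntegral hX hk hc (.const _ 1)

end TailLimit

/-! ### First moments from power tails -/

section Moments

variable {Ω : Type*} [MeasurableSpace Ω] {P : Measure Ω} [IsProbabilityMeasure P] {α C : ℝ}
  {Y : Ω → ℝ≥0}

/-- In the layer cake formula, levels below `a` each contribute at most `P(Y > a)`, in total `C * a
^ (1 - α)`; above `a` the power `s ^ (-α)` is integrable since `α > 1`. -/
theorem lintegral_tail_le (hα : 1 < α) (hC : 0 ≤ C) (hY : Measurable Y)
    (h : ∀ s : ℝ≥0, 0 < s → P.real {ω | s < Y ω} ≤ C * (s : ℝ) ^ (-α)) {a : ℝ≥0} (ha : 0 < a) :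
    ∫⁻ ω in {ω | a < Y ω}, ENNReal.ofReal (Y ω) ∂P ≤
      ENNReal.ofReal (C * (1 + (α - 1)⁻¹) * (a : ℝ) ^ (1 - α)) := by
  have ha' : (0 : ℝ) < a := ha
  have h' : ∀ s : ℝ≥0, 0 < s → P {ω | s < Y ω} ≤ ENNReal.ofReal (C * (s : ℝ) ^ (-α)) :=
    fun s hs => by
      rw [← ofReal_measureReal]
      exact ENNReal.ofReal_le_ofReal (h s hs)
  rw [lintegral_eq_lintegral_meas_lt _ (ae_of_all _ fun ω => (Y ω).coe_nonneg)
    (by fun_prop), ← Set.Ioc_union_Ioi_eq_Ioi ha'.le]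
  refine (lintegral_union_le _ _ _).trans ?_
  have h1 : ∫⁻ s in Set.Ioc (0 : ℝ) a, (P.restrict {ω | a < Y ω}) {ω | s < Y ω} ≤
      ENNReal.ofReal (C * (a : ℝ) ^ (1 - α)) := by
    calc _ ≤ ∫⁻ _s in Set.Ioc (0 : ℝ) a, ENNReal.ofReal (C * (a : ℝ) ^ (-α)) := by
          refine lintegral_mono fun s => ?_
          refine (measure_mono (Set.subset_univ _)).trans ?_
          rw [Measure.restrict_apply_univ]
          exact h' a ha
      _ = _ := by
          rw [setLIntegral_const, Real.volume_Ioc, sub_zero,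
            ← ENNReal.ofReal_mul (by positivity), mul_assoc]
          congr 2
          rw [← Real.rpow_add_one ha'.ne']
          ring_nf
  have h2 : ∫⁻ s in Set.Ioi (a : ℝ), (P.restrict {ω | a < Y ω}) {ω | s < Y ω} ≤
      ENNReal.ofReal (C * ((α - 1)⁻¹ * (a : ℝ) ^ (1 - α))) := by
    calc _ ≤ ∫⁻ s in Set.Ioi (a : ℝ), ENNReal.ofReal (C * s ^ (-α)) := by
          refine setLIntegral_mono' measurableSet_Ioi fun s hs => ?_
          have hs0 : 0 < s := ha'.trans hs
          lift s to ℝ≥0 using hs0.le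
          exact (Measure.restrict_apply_le _ _).trans (h' s hs0)
      _ = _ := by
          have hint := (integrableOn_Ioi_rpow_of_lt (show -α < -1 by linarith) ha').const_mul C
          rw [← ofReal_integral_eq_lintegral_ofReal hint
            ((ae_restrict_mem measurableSet_Ioi).mono fun s hs => by
              have hs0 : 0 < s := ha'.trans hs
              simp only [Pi.zero_apply]
              positivity), integral_const_mul, integral_Ioi_rpow_of_lt (by linarith) ha']
          congr 2
          have h3 : α - 1 ≠ 0 := by linarith
          have h4 : -α + 1 ≠ 0 := by intro h; apply h3; linarith
          rw [show -α + 1 = -(α - 1) by ring, show 1 - α = -(α - 1) by ring]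
          field_simp
  refine (add_le_add h1 h2).trans ?_
  have hα1 : 0 < α - 1 := by linarith
  rw [← ENNReal.ofReal_add (by positivity) (by positivity)]
  exact ENNReal.ofReal_le_ofReal (le_of_eq (by ring))

theorem integrable_of_tail (hα : 1 < α) (hC : 0 ≤ C) (hY : Measurable Y)
    (h : ∀ s : ℝ≥0, 0 < s → P.real {ω | s < Y ω} ≤ C * (s : ℝ) ^ (-α)) :
    Integrable (fun ω => (Y ω : ℝ)) P := by
  have hm : MeasurableSet {ω | 1 < Y ω} := measurableSet_lt measurable_const hY
  have h1 : IntegrableOn (fun ω => (Y ω : ℝ)) {ω | 1 < Y ω} P := by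
    refine ⟨by fun_prop, ?_⟩
    rw [hasFiniteIntegral_iff_ofReal (ae_of_all _ fun ω => (Y ω).coe_nonneg)]
    exact (lintegral_tail_le hα hC hY h one_pos).trans_lt ENNReal.ofReal_lt_top
  refine (((integrable_const 1).add (h1.integrable_indicator hm))).mono'
    (by fun_prop) (ae_of_all _ fun ω => ?_)
  rw [Real.norm_of_nonneg (Y ω).coe_nonneg, Pi.add_apply]
  by_cases hω : 1 < Y ω
  · rw [Set.indicator_of_mem (by exact hω)]
    linarith
  · rw [Set.indicator_of_notMem (by exact hω), add_zero]
    exact_mod_cast not_lt.1 hω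

theorem setIntegral_tail_le (hα : 1 < α) (hC : 0 ≤ C) (hY : Measurable Y)
    (h : ∀ s : ℝ≥0, 0 < s → P.real {ω | s < Y ω} ≤ C * (s : ℝ) ^ (-α)) {a : ℝ≥0} (ha : 0 < a) :
    ∫ ω in {ω | a < Y ω}, (Y ω : ℝ) ∂P ≤ C * (1 + (α - 1)⁻¹) * (a : ℝ) ^ (1 - α) := by
  have hα1 : 0 < α - 1 := by linarith
  rw [integral_eq_lintegral_of_nonneg_ae (ae_of_all _ fun ω => (Y ω).coe_nonneg) (by fun_prop)]
  exact ENNReal.toReal_le_of_le_ofReal (by positivity) (lintegral_tail_le hα hC hY h ha)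

end Moments

/-! ### Unbounded homogeneous integrands -/

section Expectation

variable {Ω : Type*} [MeasurableSpace Ω] {P : Measure Ω} [IsProbabilityMeasure P] {α : ℝ} {q : ℕ}
  {X : Ω → Fin q → ℝ≥0} {ν : Measure (Fin q → ℝ≥0)} {g h : (Fin q → ℝ≥0) → ℝ≥0}

/-- The truncation of `g` at level `c`. -/
noncomputable def truncate (hg : Continuous g) (c : ℝ≥0) : (Fin q → ℝ≥0) →ᵇ ℝ :=
  BoundedContinuousFunction.ofNormedAddCommGroup (fun x => ((min (g x) c : ℝ≥0) : ℝ))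
    (by fun_prop) c fun x => by
      rw [Real.norm_of_nonneg (NNReal.coe_nonneg _)]
      exact_mod_cast min_le_right _ _

theorem truncate_apply (hg : Continuous g) (c : ℝ≥0) (x : Fin q → ℝ≥0) :
    truncate hg c x = ((min (g x) c : ℝ≥0) : ℝ) := rfl

theorem TailLimit.integrable_comp (hX : TailLimit P X α ν) (hXm : Measurable X) (hα : 1 < α)
    (hg1 : IsOneHomogeneous g) (hg : Continuous g) : Integrable (fun ω => (g (X ω) : ℝ)) P := by
  obtain ⟨C, hC, hle⟩ := hg1.exists_le_mul_sum hg
  obtain ⟨D, hD0, hD⟩ := hX.tail_comp hC hle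
  exact integrable_of_tail hα hD0 (hg.measurable.comp hXm) hD

/-- Truncating `g` at `n + 1` reduces to bounded integrands. After rescaling, the discarded part
lives on `{g (F) > (n + 1) t}` and is of order `(n + 1) ^ (1 - α)` uniformly in `t`, which vanishes
exactly because `α > 1`. -/
theorem TailLimit.tendsto_setIntegral_homogeneous (hX : TailLimit P X α ν) (hXm : Measurable X)
    (hα : 1 < α) (hg1 : IsOneHomogeneous g) (hg : Continuous g) (hh1 : IsOneHomogeneous h)
    (hh : Continuous h) :
    IntegrableOn (fun x => (g x : ℝ)) {x | 1 < h x} ν ∧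
    Tendsto (fun t : ℝ≥0 => (t : ℝ) ^ α * ((∫ ω in {ω | t < h (X ω)}, (g (X ω) : ℝ) ∂P) / t)) atTop
      (𝓝 (∫ x in {x | 1 < h x}, (g x : ℝ) ∂ν)) := by
  obtain ⟨C, hC, hle⟩ := hg1.exists_le_mul_sum hg
  obtain ⟨C', hC', hle'⟩ := hh1.exists_le_mul_sum hh
  obtain ⟨D, hD0, hD⟩ := hX.tail_comp hC hle
  obtain ⟨D', hD0', hD'⟩ := hX.tail_comp hC' hle'
  have hα1 : 0 < α - 1 := by linarith
  have hgm : Measurable fun ω => g (X ω) := hg.measurable.comp hXm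
  have hgX := hX.integrable_comp hXm hα hg1 hg
  have hms : MeasurableSet {x | 1 < h x} := measurableSet_lt measurable_const hh.measurable
  have hfin : ν {x | 1 < h x} < ∞ := hX.limit_lt_top hC' hle' one_pos
  have htail : ∀ b t : ℝ≥0, 0 < b → 0 < t →
      (t : ℝ) ^ α * ((∫ ω in {ω | b * t < g (X ω)}, (g (X ω) : ℝ) ∂P) / t) ≤
        D * (1 + (α - 1)⁻¹) * (b : ℝ) ^ (1 - α) := by
    intro b t hb ht
    have hb' : (0 : ℝ) < b := hb
    have ht' : (0 : ℝ) < t := ht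
    have h1 := setIntegral_tail_le hα hD0 hgm hD (show 0 < b * t by positivity)
    rw [NNReal.coe_mul, Real.mul_rpow hb'.le ht'.le, Real.rpow_sub ht', Real.rpow_one] at h1
    have h2 : (0 : ℝ) < (t : ℝ) ^ α := by positivity
    rw [← mul_div_assoc, div_le_iff₀ ht', ← le_div_iff₀' h2]
    refine h1.trans (le_of_eq ?_)
    field_simp
  have htr : ∀ (n : ℕ) (t : ℝ≥0), Integrable (fun ω => truncate hg (n + 1) (t⁻¹ • X ω)) P :=
    fun n t => Integrable.of_bound
      ((truncate hg (n + 1)).continuous.measurable.comp (by fun_prop)).aestronglyMeasurable _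
      (ae_of_all _ fun _ => (truncate hg (n + 1)).norm_coe_le_norm _)
  have hdivt : ∀ t : ℝ≥0, 0 < t → ∀ ω, ((g (t⁻¹ • X ω) : ℝ≥0) : ℝ) = (g (X ω) : ℝ) / t :=
    fun t ht ω => by
      rw [hg1 _ _ (inv_pos.2 ht), NNReal.coe_mul, NNReal.coe_inv, ← div_eq_inv_mul]
  have hG := fun n : ℕ => hX.tendsto_setIntegral hXm hh1 hh (truncate hg (n + 1))
  -- A bound free of `n`, so that monotone convergence makes `g` integrable: where `g (X) > t` the
  -- moment bound applies, and elsewhere the rescaled integrand is at most `1`, leaving the tail of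
  -- `h (X)`.
  have hbound : ∀ n : ℕ, ∫ x in {x | 1 < h x}, truncate hg (n + 1) x ∂ν ≤
      D * (1 + (α - 1)⁻¹) + D' := by
    intro n
    refine le_of_tendsto (hG n) ?_
    filter_upwards [eventually_gt_atTop 0] with t ht
    have ht' : (0 : ℝ) < t := ht
    have hA := measurableSet_lt_comp hXm hh t
    have hB : MeasurableSet {ω | 1 * t < g (X ω)} := measurableSet_lt_comp hXm hg _
    have i1 : Integrable ({ω | t < h (X ω)}.indicator (1 : Ω → ℝ)) P :=
      (integrable_const (1 : ℝ)).indicator hA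
    have hle1 : ∫ ω in {ω | t < h (X ω)}, truncate hg (n + 1) (t⁻¹ • X ω) ∂P ≤
        (∫ ω in {ω | 1 * t < g (X ω)}, (g (X ω) : ℝ) ∂P) / t + P.real {ω | t < h (X ω)} := by
      rw [← integral_div, ← integral_indicator_one hA, ← integral_indicator hA,
        ← integral_indicator hB, ← integral_add ((hgX.div_const _).indicator hB) i1]
      refine integral_mono ((htr n t).indicator hA) (((hgX.div_const _).indicator hB).add i1) fun ω => ?_
      have hq0 : 0 ≤ (g (X ω) : ℝ) / t := by positivity
      simp only []
      by_cases hω : t < h (X ω)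
      · rw [Set.indicator_of_mem (by exact hω), Set.indicator_of_mem (s := {ω | t < h (X ω)})
          (by exact hω), Pi.one_apply]
        have h3 : truncate hg (n + 1) (t⁻¹ • X ω) ≤ (g (X ω) : ℝ) / t := by
          rw [truncate_apply, ← hdivt t ht]
          exact_mod_cast min_le_left _ _
        by_cases hω' : 1 * t < g (X ω)
        · rw [Set.indicator_of_mem (by exact hω')]
          linarith
        · rw [Set.indicator_of_notMem (by exact hω'), zero_add]
          refine h3.trans ?_
          rw [div_le_one ht']
          rw [one_mul] at hω'
          exact_mod_cast not_lt.1 hω'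
      · rw [Set.indicator_of_notMem (by exact hω), Set.indicator_of_notMem
          (s := {ω | t < h (X ω)}) (by exact hω), add_zero]
        exact Set.indicator_nonneg (fun ω _ => by positivity) _
    calc _ ≤ (t : ℝ) ^ α * ((∫ ω in {ω | 1 * t < g (X ω)}, (g (X ω) : ℝ) ∂P) / t) +
          (t : ℝ) ^ α * P.real {ω | 1 * t < h (X ω)} := by
          rw [← mul_add, one_mul] at *
          exact mul_le_mul_of_nonneg_left (by simpa using hle1) (by positivity)
      _ ≤ D * (1 + (α - 1)⁻¹) + D' := by
          refine add_le_add (by simpa using htail 1 t one_pos ht) ?_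
          calc _ ≤ (t : ℝ) ^ α * (D' * ((1 * t : ℝ≥0) : ℝ) ^ (-α)) :=
                mul_le_mul_of_nonneg_left (hD' _ (by positivity)) (by positivity)
            _ = _ := by rw [rpow_mul_mul_rpow_neg ht]; simp
  have htrν : ∀ n : ℕ, IntegrableOn (truncate hg (n + 1)) {x | 1 < h x} ν := fun n =>
    Measure.integrableOn_of_bounded hfin.ne
      (truncate hg (n + 1)).continuous.aestronglyMeasurable
      (ae_of_all _ fun _ => (truncate hg (n + 1)).norm_coe_le_norm _)
  have hptw : ∀ x, Tendsto (fun n : ℕ => truncate hg (n + 1) x) atTop (𝓝 (g x)) := fun x => by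
    obtain ⟨m, hm⟩ := exists_nat_ge (g x)
    refine tendsto_const_nhds.congr' ?_
    filter_upwards [eventually_ge_atTop m] with n hn
    have hn' : (m : ℝ≥0) ≤ n := by exact_mod_cast hn
    rw [truncate_apply, min_eq_left (hm.trans (hn'.trans le_self_add))]
  have hint : IntegrableOn (fun x => (g x : ℝ)) {x | 1 < h x} ν := by
    have hgc : Continuous fun x => (g x : ℝ) := by fun_prop
    refine ⟨hgc.aestronglyMeasurable, ?_⟩
    rw [hasFiniteIntegral_iff_ofReal (ae_of_all _ fun x => (g x).coe_nonneg)]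
    refine lt_of_le_of_lt (le_of_tendsto' (lintegral_tendsto_of_tendsto_of_monotone
      (f := fun (n : ℕ) x => ENNReal.ofReal (truncate hg (n + 1) x))
      (fun n => (truncate hg (n + 1)).continuous.measurable.ennreal_ofReal.aemeasurable)
      (ae_of_all _ fun x m n hmn => ?_) (ae_of_all _ fun x =>
        (ENNReal.continuous_ofReal.tendsto _).comp (hptw x)))
      (b := ENNReal.ofReal (D * (1 + (α - 1)⁻¹) + D')) fun n => ?_) ENNReal.ofReal_lt_top
    · refine ENNReal.ofReal_le_ofReal ?_
      rw [truncate_apply, truncate_apply]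
      have : (m : ℝ≥0) ≤ n := by exact_mod_cast hmn
      gcongr
    · rw [← ofReal_integral_eq_lintegral_ofReal (htrν n)
        (ae_of_all _ fun x => NNReal.coe_nonneg _)]
      exact ENNReal.ofReal_le_ofReal (hbound n)
  refine ⟨hint, tendsto_of_approx hG ?_
    (E := fun n _ => D * (1 + (α - 1)⁻¹) * (((n : ℝ≥0) + 1 : ℝ≥0) : ℝ) ^ (1 - α))
    (e := fun n => D * (1 + (α - 1)⁻¹) * (((n : ℝ≥0) + 1 : ℝ≥0) : ℝ) ^ (1 - α))
    (fun n => tendsto_const_nhds) ?_ fun n => ?_⟩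
  · refine tendsto_integral_of_dominated_convergence _ (fun n => (htrν n).1) hint
      (fun n => ae_of_all _ fun x => ?_) (ae_of_all _ hptw)
    rw [truncate_apply, Real.norm_of_nonneg (NNReal.coe_nonneg _)]
    exact_mod_cast min_le_left _ _
  · have h1 : Tendsto (fun n : ℕ => ((n + 1 : ℝ≥0) : ℝ)) atTop atTop := by
      push_cast
      exact tendsto_atTop_add_const_right _ _ tendsto_natCast_atTop_atTop
    have h2 := ((tendsto_rpow_neg_atTop hα1).comp h1).const_mul (D * (1 + (α - 1)⁻¹))
    rw [mul_zero] at h2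
    refine h2.congr fun n => ?_
    rw [Function.comp, neg_sub]
  · filter_upwards [eventually_gt_atTop 0] with t ht
    have ht' : (0 : ℝ) < t := ht
    have hA := measurableSet_lt_comp hXm hh t
    have hB := measurableSet_lt_comp hXm hg (((n : ℝ≥0) + 1) * t)
    refine le_trans ?_ (htail (n + 1) t (by positivity) ht)
    rw [← mul_sub, abs_mul, abs_of_nonneg (by positivity)]
    refine mul_le_mul_of_nonneg_left ?_ (by positivity)
    rw [← integral_div, ← integral_div,
      ← integral_sub (hgX.div_const _).integrableOn (htr n t).integrableOn,
      ← integral_indicator hA, ← integral_indicator hB]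
    refine abs_integral_le_integral_abs.trans (integral_mono
      (((hgX.div_const _).sub (htr n t)).indicator hA).abs ((hgX.div_const _).indicator hB)
      fun ω => ?_)
    have hnn : 0 ≤ {ω | ((n : ℝ≥0) + 1) * t < g (X ω)}.indicator
        (fun ω => (g (X ω) : ℝ) / t) ω := Set.indicator_nonneg (fun ω _ => by positivity) _
    simp only []
    by_cases hω : t < h (X ω)
    · rw [Set.indicator_of_mem (by exact hω), truncate_apply, ← hdivt t ht]
      by_cases hω' : ((n : ℝ≥0) + 1) * t < g (X ω)
      · rw [Set.indicator_of_mem (by exact hω'), ← hdivt t ht, abs_of_nonneg]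
        · linarith [NNReal.coe_nonneg (min (g (t⁻¹ • X ω)) ((n : ℝ≥0) + 1))]
        · rw [sub_nonneg]
          exact_mod_cast min_le_left _ _
      · rw [min_eq_left, sub_self, abs_zero]
        · exact hnn
        · rwa [← hg1.lt_inv_smul_iff ht, not_lt] at hω'
    · rw [Set.indicator_of_notMem (by exact hω), abs_zero]
      exact hnn

end Expectation

/-! ### Conditional quantities as ratios of tails -/

section Conditioning

variable {Ω : Type*} [MeasurableSpace Ω] {P : Measure Ω}

theorem integral_cond_eq (B : Set Ω) (f : Ω → ℝ) :
    ∫ ω, f ω ∂P[|B] = (P.real B)⁻¹ * ∫ ω in B, f ω ∂P := by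
  rw [ProbabilityTheory.cond, integral_smul_measure, ENNReal.toReal_inv, smul_eq_mul]
  rfl

theorem measureReal_cond_eq (B : Set Ω) {S : Set Ω} (hS : MeasurableSet S) :
    (P[|B]).real S = (P.real B)⁻¹ * P.real (B ∩ S) := by
  rw [Measure.real, cond_apply' hS, ENNReal.toReal_mul, ENNReal.toReal_inv]
  rfl

/-- Both the rate `t ^ α` and the unknown constant `c` cancel in the quotient. -/
theorem tendsto_inv_mul_of_tendsto_rpow_mul {α c a b : ℝ} (hc : c ≠ 0) (hb : b ≠ 0)
    {f p : ℝ≥0 → ℝ}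
    (hf : Tendsto (fun t : ℝ≥0 => (t : ℝ) ^ α * f t) atTop (𝓝 (c * a)))
    (hp : Tendsto (fun t : ℝ≥0 => (t : ℝ) ^ α * p t) atTop (𝓝 (c * b))) :
    Tendsto (fun t => (p t)⁻¹ * f t) atTop (𝓝 (a / b)) := by
  have h := hf.div hp (mul_ne_zero hc hb)
  rw [mul_div_mul_left _ _ hc] at h
  refine h.congr' ?_
  filter_upwards [eventually_gt_atTop 0] with t ht
  have : (t : ℝ) ^ α ≠ 0 := (Real.rpow_pos_of_pos ht _).ne'
  rw [Pi.div_apply, mul_div_mul_left _ _ this, div_eq_inv_mul]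

end Conditioning

/-! ### Moments of the adjacency matrix and the limit measure -/

section RandomMatrix

/-- A norm on a finite dimensional space dominates every linear functional. -/
theorem IsNorm.exists_abs_le {E : Type*} [AddCommGroup E] [Module ℝ E] [FiniteDimensional ℝ E]
    {M : Seminorm ℝ E} (hM : IsNorm M) (L : E →ₗ[ℝ] ℝ) : ∃ C : ℝ, 0 ≤ C ∧ ∀ x, |L x| ≤ C * M x := by
  -- Equipping `E` with `M` itself as its norm makes `L` continuous by finite dimension, and its
  -- operator norm is the constant.
  let _ : Norm E := ⟨M⟩
  have core : NormedSpace.Core ℝ E :=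
    { norm_nonneg := fun x => apply_nonneg M x
      norm_smul := fun c x => map_smul_eq_mul M c x
      norm_triangle := fun x y => map_add_le_add M x y
      norm_eq_zero_iff := fun x => ⟨hM x, fun h => by rw [h]; exact map_zero M⟩ }
  let _ : NormedAddCommGroup E := NormedAddCommGroup.ofCore core
  let _ : NormedSpace ℝ E := NormedSpace.ofCore core
  exact ⟨‖LinearMap.toContinuousLinearMap L‖, norm_nonneg _,
    fun x => (LinearMap.toContinuousLinearMap L).le_opNorm x⟩

/-- Breiman's lemma asks only for a moment of order `α`, which the moment of order `α + δ` controls.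
-/
theorem rpow_le_one_add_rpow {α δ x : ℝ} (hα : 0 < α) (hδ : 0 < δ) (hx : 0 ≤ x) :
    x ^ α ≤ 1 + x ^ (α + δ) := by
  rcases le_total x 1 with h | h
  · have h1 := Real.rpow_le_one hx h hα.le
    have h2 : 0 ≤ x ^ (α + δ) := by positivity
    linarith
  · have h1 : x ^ α ≤ x ^ (α + δ) := Real.rpow_le_rpow_of_exponent_le h (by linarith)
    linarith

variable {Ω : Type*} [MeasurableSpace Ω] {P : Measure Ω} {q d : ℕ}
  {W : Ω → Matrix (Fin q) (Fin d) ℝ≥0} {adj : Ω → Fin q → Fin d → Prop}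

theorem measurable_weightedAdjacency (hW : Measurable W) (hadj : Measurable adj) :
    Measurable (weightedAdjacency W adj) := by
  classical
  refine measurable_pi_lambda _ fun i => measurable_pi_lambda _ fun j => ?_
  have h1 : MeasurableSet {ω | adj ω i j} :=
    measurableSet_setOfPred.2 ((measurable_pi_apply j).comp ((measurable_pi_apply i).comp hadj))
  have h2 : Measurable fun ω => W ω i j :=
    (measurable_pi_apply j).comp ((measurable_pi_apply i).comp hW)
  exact Measurable.ite h1 h2 measurable_const

theorem weightedAdjacency_le {Ω : Type*} {W : Ω → Matrix (Fin q) (Fin d) ℝ≥0}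
    {adj : Ω → Fin q → Fin d → Prop} (ω : Ω) (i : Fin q) (j : Fin d) :
    weightedAdjacency W adj ω i j ≤ W ω i j := by
  rw [weightedAdjacency, Matrix.of_apply]
  split_ifs
  · exact le_rfl
  · exact zero_le

theorem integrable_sum_weightedAdjacency_rpow [IsFiniteMeasure P] (hW : Measurable W)
    (hadj : Measurable adj) {M : Seminorm ℝ (Matrix (Fin q) (Fin d) ℝ)} (hM : IsNorm M)
    {α δ : ℝ} (hα : 0 < α) (hδ : 0 < δ)
    (hWint : Integrable (fun ω => M ((W ω).map (fun w => (w : ℝ))) ^ (α + δ)) P) :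
    Integrable
      (fun ω => ((∑ i, ∑ j, weightedAdjacency W adj ω i j : ℝ≥0) : ℝ) ^ α) P := by
  let L : Matrix (Fin q) (Fin d) ℝ →ₗ[ℝ] ℝ := ∑ i, ∑ j, Matrix.entryLinearMap ℝ ℝ i j
  obtain ⟨C, hC0, hC⟩ := hM.exists_abs_le L
  have hm : Measurable fun ω => ((∑ i, ∑ j, weightedAdjacency W adj ω i j : ℝ≥0) : ℝ) ^ α :=
    (measurable_sum_entries (measurable_weightedAdjacency hW hadj)).coe_nnreal_real.pow_const _
  refine (((integrable_const 1).add hWint).const_mul (C ^ α)).mono' hm.aestronglyMeasurable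
    (ae_of_all _ fun ω => ?_)
  have hM0 : 0 ≤ M ((W ω).map (fun w => (w : ℝ))) := apply_nonneg _ _
  rw [Real.norm_of_nonneg (by positivity)]
  calc _ ≤ (C * M ((W ω).map (fun w => (w : ℝ)))) ^ α := by
        refine Real.rpow_le_rpow (NNReal.coe_nonneg _) ?_ hα.le
        refine le_trans ?_ (hC _)
        refine le_trans ?_ (le_abs_self _)
        have e : L ((W ω).map (fun w => (w : ℝ))) = ((∑ i, ∑ j, W ω i j : ℝ≥0) : ℝ) := by
          simp [L]
        rw [e, NNReal.coe_le_coe]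
        exact Finset.sum_le_sum fun i _ => Finset.sum_le_sum fun j _ => weightedAdjacency_le ω i j
    _ ≤ _ := by
        rw [Real.mul_rpow hC0 hM0]
        exact mul_le_mul_of_nonneg_left (rpow_le_one_add_rpow hα hδ hM0) (by positivity)

theorem map_prod_smul_map_toOrthant [IsProbabilityMeasure P]
    {A : Ω → Matrix (Fin q) (Fin d) ℝ≥0} (hA : Measurable A) (μ : Measure (ExtOrthant d))
    [SFinite μ] (c : ℝ≥0) :
    (P.prod (c • μ.map ExtOrthant.toOrthant)).map (fun p => A p.1 *ᵥ p.2) =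
      c • meanImage P A μ := by
  have hτ := ExtOrthant.measurable_toOrthant (d := d)
  have h1 : P.prod (μ.map ExtOrthant.toOrthant) =
      (P.prod μ).map (Prod.map id ExtOrthant.toOrthant) := by
    rw [← Measure.map_prod_map P μ measurable_id hτ, Measure.map_id]
  have hm : Measurable fun p : Ω × (Fin d → ℝ≥0) => A p.1 *ᵥ p.2 :=
    measurable_mulVec (hA.comp measurable_fst) measurable_snd
  rw [Measure.prod_smul_right, Measure.map_smul, h1, Measure.map_map hm (measurable_id.prodMap hτ)]
  rfl

end RandomMatrix

/-! ### Limits under conditioning on `h (F) > t` -/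

section Conclusions

variable {Ω : Type*} [MeasurableSpace Ω] {P : Measure Ω} [IsProbabilityMeasure P] {α : ℝ} {q : ℕ}
  {F : Ω → Fin q → ℝ≥0} {ν : Measure (Fin q → ℝ≥0)} {g h : (Fin q → ℝ≥0) → ℝ≥0} {c : ℝ≥0}

theorem TailLimit.measure_lt_top_of_smul {P : Measure Ω} (hF : TailLimit P F α (c • ν)) (hc : 0 < c)
    (hh1 : IsOneHomogeneous h) (hh : Continuous h) : ν {x | 1 < h x} < ∞ := by
  obtain ⟨C, hC, hle⟩ := hh1.exists_le_mul_sum hh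
  have := hF.limit_lt_top hC hle one_pos
  rw [Measure.smul_apply, ENNReal.smul_def, smul_eq_mul] at this
  exact ENNReal.lt_top_of_mul_ne_top_right this.ne (by exact_mod_cast hc.ne')

theorem TailLimit.tendsto_measureReal_smul (hF : TailLimit P F α (c • ν)) (hFm : Measurable F)
    (hh1 : IsOneHomogeneous h) (hh : Continuous h) :
    Tendsto (fun t : ℝ≥0 => (t : ℝ) ^ α * P.real {ω | t < h (F ω)}) atTop
      (𝓝 (c * ν.real {x | 1 < h x})) := by
  simpa [NNReal.smul_def] using hF.tendsto_measureReal hFm hh1 hh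

/-- The events decrease in `t`, and the nonzero limit of the rescaled tail provides arbitrarily
large levels of positive probability. -/
theorem TailLimit.measure_ne_zero (hF : TailLimit P F α (c • ν)) (hFm : Measurable F)
    (hc : 0 < c) (hh1 : IsOneHomogeneous h) (hh : Continuous h) (hpos : ν.real {x | 1 < h x} ≠ 0)
    (t : ℝ≥0) : P {ω | t < h (F ω)} ≠ 0 := by
  have hc' : (c : ℝ) ≠ 0 := by exact_mod_cast hc.ne'
  have h1 := (hF.tendsto_measureReal_smul hFm hh1 hh).eventually_ne (mul_ne_zero hc' hpos)
  obtain ⟨s, hs1, hs2⟩ := (h1.and (eventually_ge_atTop t)).exists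
  intro h0
  apply hs1
  have : P {ω | s < h (F ω)} = 0 := measure_mono_null (fun ω hω => lt_of_le_of_lt hs2 hω) h0
  rw [measureReal_def, this]
  simp

/-- The joint event is itself a level set, of the continuous one-homogeneous function `min (u⁻¹ * h)
g`. The factor `u ^ α` comes from the denominator, a tail taken at `u * t`. -/
theorem TailLimit.tendsto_cond_measureReal (hF : TailLimit P F α (c • ν)) (hFm : Measurable F)
    (hc : 0 < c) (hg1 : IsOneHomogeneous g) (hg : Continuous g) (hh1 : IsOneHomogeneous h)
    (hh : Continuous h) (hpos : ν.real {x | 1 < h x} ≠ 0) {u : ℝ≥0} (hu : 0 < u) :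
    Tendsto (fun t : ℝ≥0 => (P[|{ω | u * t < h (F ω)}]).real {ω | t < g (F ω)}) atTop
      (𝓝 ((u : ℝ) ^ α * (ν.real {x | u < h x ∧ 1 < g x} / ν.real {x | 1 < h x}))) := by
  have hc' : (c : ℝ) ≠ 0 := by exact_mod_cast hc.ne'
  have hu' : (0 : ℝ) < (u : ℝ) ^ α := Real.rpow_pos_of_pos hu _
  have hk1 : IsOneHomogeneous fun x => min (u⁻¹ * h x) (g x) := fun a x ha => by
    simp only [hh1 a x ha, hg1 a x ha]
    rw [mul_left_comm, mul_min]
  have hk : Continuous fun x => min (u⁻¹ * h x) (g x) := by fun_prop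
  have hiff : ∀ t x, t < min (u⁻¹ * h x) (g x) ↔ u * t < h x ∧ t < g x := fun t x => by
    rw [lt_min_iff, ← div_eq_inv_mul, lt_div_iff₀' hu]
  have h1 := hF.tendsto_measureReal_smul hFm hk1 hk
  simp only [hiff, mul_one] at h1
  have h2 : Tendsto (fun t : ℝ≥0 => (t : ℝ) ^ α * P.real {ω | u * t < h (F ω)}) atTop
      (𝓝 (c * (((u : ℝ) ^ α)⁻¹ * ν.real {x | 1 < h x}))) := by
    have h3 := ((hF.tendsto_measureReal_smul hFm hh1 hh).comp
      (tendsto_id.const_mul_atTop hu)).const_mul (((u : ℝ) ^ α)⁻¹)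
    rw [mul_left_comm] at h3
    refine h3.congr fun t => ?_
    simp only [Function.comp, id, NNReal.coe_mul]
    rw [Real.mul_rpow u.coe_nonneg t.coe_nonneg]
    field_simp
  have h4 := tendsto_inv_mul_of_tendsto_rpow_mul hc' (mul_ne_zero (inv_ne_zero hu'.ne') hpos) h1 h2
  have e : ν.real {x | u < h x ∧ 1 < g x} / (((u : ℝ) ^ α)⁻¹ * ν.real {x | 1 < h x}) =
      (u : ℝ) ^ α * (ν.real {x | u < h x ∧ 1 < g x} / ν.real {x | 1 < h x}) := by
    field_simp
  rw [e] at h4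
  refine h4.congr fun t => ?_
  rw [measureReal_cond_eq _ (measurableSet_lt_comp hFm hg t)]
  rfl

theorem TailLimit.tendsto_cond_integral (hF : TailLimit P F α (c • ν)) (hFm : Measurable F)
    (hc : 0 < c) (hh1 : IsOneHomogeneous h) (hh : Continuous h)
    (hpos : ν.real {x | 1 < h x} ≠ 0) (f : (Fin q → ℝ≥0) →ᵇ ℝ) :
    Tendsto (fun t : ℝ≥0 => ∫ ω, f (t⁻¹ • F ω) ∂P[|{ω | t < h (F ω)}]) atTop
      (𝓝 ((∫ x in {x | 1 < h x}, f x ∂ν) / ν.real {x | 1 < h x})) := by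
  have hc' : (c : ℝ) ≠ 0 := by exact_mod_cast hc.ne'
  have h1 := hF.tendsto_setIntegral hFm hh1 hh f
  rw [Measure.restrict_smul, integral_smul_nnreal_measure, NNReal.smul_def, smul_eq_mul] at h1
  simp_rw [integral_cond_eq]
  exact tendsto_inv_mul_of_tendsto_rpow_mul hc' hpos h1 (hF.tendsto_measureReal_smul hFm hh1 hh)

theorem TailLimit.tendsto_cond_integral_homogeneous (hF : TailLimit P F α (c • ν))
    (hFm : Measurable F) (hc : 0 < c) (hα : 1 < α) (hg1 : IsOneHomogeneous g) (hg : Continuous g)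
    (hh1 : IsOneHomogeneous h) (hh : Continuous h) (hpos : ν.real {x | 1 < h x} ≠ 0) :
    IntegrableOn (fun x => (g x : ℝ)) {x | 1 < h x} ν ∧
    Tendsto (fun t : ℝ≥0 => (∫ ω, (g (F ω) : ℝ) ∂P[|{ω | t < h (F ω)}]) / t) atTop
        (𝓝 ((∫ x in {x | 1 < h x}, (g x : ℝ) ∂ν) / ν.real {x | 1 < h x})) := by
  have hc' : (c : ℝ) ≠ 0 := by exact_mod_cast hc.ne'
  obtain ⟨hi, h1⟩ := hF.tendsto_setIntegral_homogeneous hFm hα hg1 hg hh1 hh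
  rw [Measure.restrict_smul, integral_smul_nnreal_measure, NNReal.smul_def, smul_eq_mul] at h1
  constructor
  · rw [IntegrableOn, Measure.restrict_smul] at hi
    exact (integrable_smul_measure (c := (c : ℝ≥0∞)) (by exact_mod_cast hc.ne')
      ENNReal.coe_ne_top).1 hi
  · simp_rw [integral_cond_eq, mul_div_assoc]
    exact tendsto_inv_mul_of_tendsto_rpow_mul hc' hpos h1 (hF.tendsto_measureReal_smul hFm hh1 hh)

theorem isEquivalent_of_tendsto_div {a : ℝ≥0 → ℝ} {I m : ℝ} (hI : I ≠ 0) (hm : m ≠ 0)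
    (ha : Tendsto (fun t : ℝ≥0 => a t / t) atTop (𝓝 (I / m))) :
    a ~[atTop] fun t : ℝ≥0 => (t : ℝ) / m * I := by
  have ht : ∀ᶠ t : ℝ≥0 in atTop, (t : ℝ) ≠ 0 := by
    filter_upwards [eventually_gt_atTop 0] with t ht
    exact_mod_cast ht.ne'
  rw [isEquivalent_iff_tendsto_one (ht.mono fun t h => mul_ne_zero (div_ne_zero h hm) hI)]
  have h1 := ha.div_const (I / m)
  rw [div_self (div_ne_zero hI hm)] at h1
  refine h1.congr fun t => ?_
  rw [Pi.div_apply, div_div]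
  congr 1
  ring

end Conclusions

/-! ### The limit theorem for the random bipartite network -/

theorem theorem3p3 {Ω : Type*} [MeasurableSpace Ω] (P : Measure Ω) [IsProbabilityMeasure P]
    {q d : ℕ}
    -- the claims: regularly varying with Pareto tails
    (V : Ω → Fin d → ℝ≥0) (hV : Measurable V)
    (N : Seminorm ℝ (Fin d → ℝ)) (hN : IsNorm N)
    (μ : Measure (ExtOrthant d)) (hRV : IsRegularlyVarying P N V μ)
    (α : ℝ) (hα : 0 < α) (K : Fin d → ℝ) (hK : ∀ j, 0 < K j)
    (hPareto : ∀ j, (fun t : ℝ≥0 => P.real {ω | t < V ω j}) ~[atTop]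
      (fun t : ℝ≥0 => K j * (t : ℝ) ^ (-α)))
    -- the random weights and the random bipartite graph
    (W : Ω → Matrix (Fin q) (Fin d) ℝ≥0) (hW : Measurable W)
    (adj : Ω → Fin q → Fin d → Prop) (hadj : Measurable adj)
    (M : Seminorm ℝ (Matrix (Fin q) (Fin d) ℝ)) (hM : IsNorm M) (δ : ℝ) (hδ : 0 < δ)
    (hWint : Integrable (fun ω => M ((W ω).map (fun w => (w : ℝ))) ^ (α + δ)) P)
    (A : Ω → Matrix (Fin q) (Fin d) ℝ≥0) (hA : A = weightedAdjacency W adj)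
    (hindep : IndepFun A V P)
    (F : Ω → Fin q → ℝ≥0) (hF : F = fun ω => A ω *ᵥ V ω)
    (μt : Measure (Fin q → ℝ≥0)) (hμt : μt = meanImage P A μ)
    (g h : (Fin q → ℝ≥0) → ℝ≥0) (hg : Continuous g) (hh : Continuous h)
    (hg1 : IsOneHomogeneous g) (hh1 : IsOneHomogeneous h)
    -- the denominators below do not vanish
    (hpos : μt {x | 1 < h x} ≠ 0) :
    -- the conditional probabilities and the ratios below are well defined
    (∀ t : ℝ≥0, P {ω | t < h (F ω)} ≠ 0) ∧ μt {x | 1 < h x} < ∞ ∧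
    -- (a)
    (∀ u : ℝ≥0, 0 < u →
      Tendsto (fun t : ℝ≥0 => (P[|{ω | u * t < h (F ω)}]).real {ω | t < g (F ω)}) atTop
        (𝓝 ((u : ℝ) ^ α * (μt.real {x | u < h x ∧ 1 < g x} / μt.real {x | 1 < h x})))) ∧
    -- (b) for bounded or compactly supported `g`
    (((∃ C : ℝ≥0, ∀ x, g x ≤ C) ∨ HasCompactSupportInExtOrthant g) →
      (fun t : ℝ≥0 => ∫ ω, (g (F ω) : ℝ) ∂P[|{ω | t < h (F ω)}]) ~[atTop]
        (fun t : ℝ≥0 => (t : ℝ) / μt.real {x | 1 < h x} * ∫ x in {x | 1 < h x}, (g x : ℝ) ∂μt)) ∧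
    -- (b) for all `g`, when the first moments are finite
    (1 < α →
      Integrable (fun ω => (g (F ω) : ℝ)) P ∧
      IntegrableOn (fun x => (g x : ℝ)) {x | 1 < h x} μt ∧
      Tendsto (fun t : ℝ≥0 => (∫ ω, (g (F ω) : ℝ) ∂P[|{ω | t < h (F ω)}]) / t) atTop
        (𝓝 ((∫ x in {x | 1 < h x}, (g x : ℝ) ∂μt) / μt.real {x | 1 < h x})) ∧
      (∫ x in {x | 1 < h x}, (g x : ℝ) ∂μt ≠ 0 →
        (fun t : ℝ≥0 => ∫ ω, (g (F ω) : ℝ) ∂P[|{ω | t < h (F ω)}]) ~[atTop]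
          (fun t : ℝ≥0 =>
            (t : ℝ) / μt.real {x | 1 < h x} * ∫ x in {x | 1 < h x}, (g x : ℝ) ∂μt))) ∧
    -- (b) for bounded continuous integrands that need not be homogeneous, after rescaling
    (∀ f : (Fin q → ℝ≥0) →ᵇ ℝ,
      Tendsto (fun t : ℝ≥0 => ∫ ω, f (t⁻¹ • F ω) ∂P[|{ω | t < h (F ω)}]) atTop
        (𝓝 ((∫ x in {x | 1 < h x}, f x ∂μt) / μt.real {x | 1 < h x}))) := by
  have := hRV.radon
  have hAm : Measurable A := hA ▸ measurable_weightedAdjacency hW hadj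
  have hFm : Measurable F := hF ▸ measurable_mulVec hAm hV
  obtain ⟨c, hc, hTV⟩ := hRV.exists_tailLimit hV hα hK hPareto
  have hmom : Integrable (fun ω => ((∑ i, ∑ j, A ω i j : ℝ≥0) : ℝ) ^ α) P :=
    hA ▸ integrable_sum_weightedAdjacency_rpow hW hadj hM hα hδ hWint
  have hT : TailLimit P F α (c • μt) := by
    rw [hF, hμt, ← map_prod_smul_map_toOrthant hAm]
    exact hTV.mulVec hV hAm hindep hmom
  have hfin := hT.measure_lt_top_of_smul hc hh1 hh
  have hpos' : μt.real {x | 1 < h x} ≠ 0 := (ENNReal.toReal_pos hpos hfin.ne).ne'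
  refine ⟨hT.measure_ne_zero hFm hc hh1 hh hpos', hfin,
    fun u hu => hT.tendsto_cond_measureReal hFm hc hg1 hg hh1 hh hpos' hu, fun hcase => ?_,
    fun hα1 => ?_, hT.tendsto_cond_integral hFm hc hh1 hh hpos'⟩
  -- Either alternative forces `g` to vanish, so both sides of the equivalence are `0`.
  · have hg0 : ∀ x, g x = 0 := by
      rcases hcase with ⟨C, hC⟩ | hcs
      · exact hg1.eq_zero_of_le hC
      · exact hg1.eq_zero_of_hasCompactSupport hcs
    simpa [hg0] using IsEquivalent.refl
  · obtain ⟨hi, hlim⟩ := hT.tendsto_cond_integral_homogeneous hFm hc hα1 hg1 hg hh1 hh hpos'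
    exact ⟨hT.integrable_comp hFm hα1 hg1 hg, hi, hlim,
      fun hI => isEquivalent_of_tendsto_div hI hpos' hlim⟩
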